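/- **Theorem 2.2.** Let $T>0$, $L_0\ge 0$, $\Gamma^*>0$, and let $U,\Gamma:[0,\infty)\times[0,\infty)\to\mathbb R$ satisfy the following assumptions. (i) $U$ is continuous and nonnegative; $x\mapsto U(t,x)$ is Lipschitz continuous with a constant $U_{Lip}$ that does not depend on $t\ge 0$; and $U(t,0)\le U_{0\max}$ for all $t\ge0$. (ii) $\Gamma$ is continuous, $0\le \Gamma(t,x)\le\Gamma_{\max}$ for all $t,x\ge 0$, and the partial derivative $\frac{\partial\Gamma}{\partial t}(t,x)$ exists with $\left|\frac{\partial\Gamma}{\partial t}(t,x)\right|\le C_\Gamma$ for all $t>0$, $x\ge0$. (iii) For all $t\ge 0$, $\displaystyle \inf_{y> L_0}\ \frac1{y-L_0}\int_{L_0}^y\Gamma(t,\sigma)\,d\sigma>\Gamma^*$. Let $K=[\Gamma^*,\infty)$; for $\zeta\in K$ let $N_K(\zeta)=\partial I_K(\zeta)=\{\chi\in\mathbb R:\ \chi(\zeta-\bar\zeta)\ge0\ \ \forall\bar\zeta\in K\}$. Let $\mathcal K=\{z\in L^\infty(0,T):\ z(t)\ge\Gamma^*\text{ a.e. } t\in(0,T)\}$;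 for $z\in\mathcal K$ let $\mathcal N_{\mathcal K}(z)=\{\eta\in(L^\infty(0,T))^*:\ \eta(z-y)\ge0\ \ \forall y\in\mathcal K\}$. (Both cones are empty at points outside $K$ and $\mathcal K$, respectively.) A functional $\nu\in(L^\infty(0,T))^*$ is called singular if there are measurable sets $S_0\subset S_1\subset\cdots$ that cover $(0,T)$ up to a null set, such that for each $k$, $\nu(\varphi)=0$ for every $\varphi\in L^\infty(0,T)$ that vanishes a.e. outside $S_k$. Then the differential inclusion $$\frac{dL}{dt}(t)+\partial I_K(\Gamma(t,L(t)))\ni U(t,L(t)),\qquad L(0)=L_0,$$ has at least one generalized solution on $[0,T]$, in the following sense. There are a function $L:[0,T]\to[0,\infty)$ of bounded variation with $L(0)=L_0$, a decomposition $L=L^a+L^s$ on $[0,T]$ with $L^a$ absolutely continuous on $[0,T]$ and $L^s$ of bounded variation on $[0,T]$ with derivative zero a.e., and a functional $\mu\in(L^\infty(0,T))^*$ with $\mu=\mu_a+\mu_s$, where $\mu_a\in L^1(0,T)$ (acting on $L^\infty(0,T)$ by integration) and $\mu_s\in(L^\infty(0,T))^*$ is singular, such that $$\frac{dL^a}{dt}(t)+\mu_a(t)=U(t,L(t))\quad\text{a.e.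 }t\in(0,T),$$ $$\frac{dL^s}{dt}+\mu_s=0\quad\text{in }\mathcal D'(0,T),\ \text{ i.e. } -\int_0^T L^s\varphi'\,dt+\mu_s(\varphi)=0\ \ \forall\varphi\in C_c^\infty(0,T),$$ $$\mu_a(t)\in N_K(\Gamma(t,L(t)))\quad\text{a.e. }t\in(0,T),$$ $$\Gamma(\cdot,L(\cdot))\in L^\infty(0,T)\quad\text{and}\quad \mu_s\in\mathcal N_{\mathcal K}(\Gamma(\cdot,L(\cdot))).$$ -/

import Mathlib

open Set MeasureTheory
open scoped ENNReal NNReal ContDiff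

namespace Disturbance

noncomputable section

/-- Lebesgue measure on the open interval `(0,T)`. -/
abbrev vol (T : ℝ) : Measure ℝ := volume.restrict (Ioo 0 T)

/-- The Banach space `L^∞(0,T)` of classes of essentially bounded real functions. -/
abbrev Linf (T : ℝ) : Type := Lp ℝ ∞ (vol T)

/-- The dual space `(L^∞(0,T))^*`. -/
abbrev LinfDual (T : ℝ) : Type := StrongDual ℝ (Linf T)

/-- The half-line `K = {z ∈ ℝ : z ≥ Γ^*}`. -/
def K (Γstar : ℝ) : Set ℝ := Ici Γstar

/-- The normal cone `N_K(ζ) = ∂I_K(ζ)` to `K` at a point `ζ ∈ K`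
(empty at points outside `K`). -/
def normalConeK (Γstar ζ : ℝ) : Set ℝ :=
  {χ | ζ ∈ K Γstar ∧ ∀ ζ' ∈ K Γstar, 0 ≤ χ * (ζ - ζ')}

/-- The set of all `z ∈ L^∞(0,T)` with `z(t) ≥ Γ^*` for a.e. `t ∈ (0,T)`. -/
def constraintSet (T Γstar : ℝ) : Set (Linf T) :=
  {z | ∀ᵐ t ∂(vol T), z t ∈ K Γstar}

/-- The normal cone in `(L^∞(0,T))^*` to the set `constraintSet` at one of its points `z`
(empty at points outside this set). -/
def normalCone (T Γstar : ℝ) (z : Linf T) : Set (LinfDual T) :=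
  {η | z ∈ constraintSet T Γstar ∧ ∀ y ∈ constraintSet T Γstar, 0 ≤ η (z - y)}

/-- A functional on `L^∞(0,T)` is singular if there are measurable sets `S 0 ⊆ S 1 ⊆ …`
which exhaust `(0,T)` up to a null set, such that the functional vanishes at every
function that is zero a.e. outside one of the sets `S k`. -/
def IsSingular {T : ℝ} (μ : LinfDual T) : Prop :=
  ∃ S : ℕ → Set ℝ, (∀ k, MeasurableSet (S k)) ∧ Monotone S ∧
    (∀ᵐ t ∂(vol T), ∃ k, t ∈ S k) ∧
    ∀ k, ∀ φ : Linf T, (∀ᵐ t ∂(vol T), t ∉ S k → φ t = 0) → μ φ = 0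

/-- `μ = μ_a + μ_s`, where `μ_a ∈ L^1(0,T)` acts on `L^∞(0,T)` by integration
and `μ_s` is singular: the Lebesgue decomposition of `μ ∈ (L^∞(0,T))^*`. -/
structure IsLebesgueDecomposition {T : ℝ} (μ : LinfDual T) (μa : ℝ → ℝ) (μs : LinfDual T) :
    Prop where
  integrable : Integrable μa (vol T)
  singular : IsSingular μs
  decomp : ∀ φ : Linf T, μ φ = ∫ t, μa t * φ t ∂(vol T) + μs φ

/-- `v = v^a + v^s` on `[0,T]`: a function `v` of bounded variation is the sum of an
absolutely continuous function and of a singular function, that is, a function of bounded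
variation whose derivative is zero a.e. -/
structure IsBVDecomposition (T : ℝ) (v va vs : ℝ → ℝ) : Prop where
  bv : BoundedVariationOn v (Icc 0 T)
  ac : AbsolutelyContinuousOnInterval va 0 T
  bv_singular : BoundedVariationOn vs (Icc 0 T)
  deriv_singular : ∀ᵐ t ∂(vol T), HasDerivAt vs 0 t
  decomp : ∀ t ∈ Icc 0 T, v t = va t + vs t

/-- Test functions: `φ ∈ C_c^∞(0,T)`. -/
structure IsTestFunction (T : ℝ) (φ : ℝ → ℝ) : Prop where
  smooth : ContDiff ℝ ∞ φ
  compact : HasCompactSupport φ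
  support : tsupport φ ⊆ Ioo 0 T

theorem IsTestFunction.memLp {T : ℝ} {φ : ℝ → ℝ} (h : IsTestFunction T φ) :
    MemLp φ ∞ (vol T) :=
  h.smooth.continuous.memLp_top_of_hasCompactSupport h.compact _

/-- `dv/dt + μ = 0` in the sense of distributions on `(0,T)`. -/
def DistribDerivAddEqZero {T : ℝ} (v : ℝ → ℝ) (μ : LinfDual T) : Prop :=
  ∀ (φ : ℝ → ℝ) (hφ : IsTestFunction T φ),
    -(∫ t, v t * deriv φ t ∂(vol T)) + μ hφ.memLp.toLp = 0

/-- `L = L^a + L^s`, together with `μ = μ_a + μ_s ∈ (L^∞(0,T))^*`, is a generalized solution on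
`[0,T]` of `dL/dt + ∂I_K(Γ(t,L(t))) ∋ U(t,L(t))`, `L(0) = L₀`. The functions `U` and `Γ` matter
only on `[0,∞) × [0,∞)`, hence `L` has to have values in `[0,∞)`. -/
structure IsGeneralizedSolution (U Γ : ℝ → ℝ → ℝ) (Γstar L₀ T : ℝ)
    (L La Ls : ℝ → ℝ) (μ : LinfDual T) (μa : ℝ → ℝ) (μs : LinfDual T) : Prop where
  nonneg : ∀ t ∈ Icc 0 T, 0 ≤ L t
  init : L 0 = L₀
  decomp_L : IsBVDecomposition T L La Ls
  decomp_μ : IsLebesgueDecomposition μ μa μs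
  eq_ac : ∀ᵐ t ∂(vol T), DifferentiableAt ℝ La t ∧ deriv La t + μa t = U t (L t)
  eq_singular : DistribDerivAddEqZero Ls μs
  normal_ac : ∀ᵐ t ∂(vol T), μa t ∈ normalConeK Γstar (Γ t (L t))
  memLp_Γ : MemLp (fun t => Γ t (L t)) ∞ (vol T)
  normal_singular : μs ∈ normalCone T Γstar memLp_Γ.toLp

/-- The averaged cohesion at time `t`: the infimum over `y > L₀` of the mean value of
`Γ(t,·)` over `[L₀,y]`. -/
def avgCohesion (Γ : ℝ → ℝ → ℝ) (L₀ t : ℝ) : ℝ :=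
  ⨅ y : Ioi L₀, (1 / ((y : ℝ) - L₀)) * ∫ σ in L₀..(y : ℝ), Γ t σ

end

end Disturbance

/-! The solution `L` is the least upper function: the infimum of all functions that start above L₀,
satisfy Γ* ≤ Γ(t,f(t)) and are not crossed upwards by affine strict subsolutions of x' = U(t,x).
These properties survive infima. Since U ≥ 0, `L` is nondecreasing. Minimality
(`minUpper_le_of_modification`) makes it left continuous, lets it jump only through points with Γ ≤
Γ*, and gives it the right derivative U wherever Γ > Γ*. Hence L' ≥ U a.e., with equality off the
contact set, so μ_a = U - L' lies in the normal cone. Moreover Γ(t,L(t)) is continuous in t even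
across jumps, as both ends of a jump have Γ = Γ*.

The singular part of `L` is nondecreasing, and constant on intervals where Γ > Γ*. In
`exists_singular_functional`, μ_s is minus an ultrafilter limit of its backward difference
quotients, which are bounded in L¹. They tend to 0 a.e., so μ_s is singular. Also μ_s ≤ 0, and μ_s
vanishes on Γ(·,L) - Γ*; together these are the normal cone condition.

Blow-up is excluded by an energy estimate (`minUpper_lt`). By compactness the averaged hypothesis
holds on [0,T] with a uniform gap δ, so the integral of Γ - (Γ* + δ/2) over [L₀,L(t)] controls L(t)
- L₀. Jumps cross a region of negative integrand, and the remaining growth is of Gronwall type. Thus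
U and Γ may be truncated at a large R that `L` never reaches. -/

namespace Disturbance

/-! ### The minimal upper function and its regularity. -/

section Minimal

open Filter Topology

/-- `f` starts above `x₀`, satisfies the constraint `c ≤ Γ(t,f(t))`, and never falls below an affine
strict subsolution of `x' = U(t,x)` once it is above it. -/
structure IsUpper (U Γ : ℝ → ℝ → ℝ) (c x₀ : ℝ) (f : ℝ → ℝ) : Prop where
  init : x₀ ≤ f 0
  constr : ∀ t, 0 ≤ t → c ≤ Γ t (f t)
  growth : ∀ s t a m, 0 ≤ s → s ≤ t → (∀ r ∈ Icc s t, m < U r (a + m * (r - s))) → a ≤ f s →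
    a + m * (t - s) ≤ f t

/-- The pointwise infimum of all upper functions, extended by its value at `0` to `t < 0`. -/
noncomputable def minUpper (U Γ : ℝ → ℝ → ℝ) (c x₀ t : ℝ) : ℝ :=
  sInf ((fun f : ℝ → ℝ => f (max t 0)) '' {f | IsUpper U Γ c x₀ f})

/-- Global assumptions under which the minimal upper function exists. -/
structure IsRegular (U Γ : ℝ → ℝ → ℝ) (c x₀ : ℝ) : Prop where
  contU : Continuous (Function.uncurry U)
  contΓ : Continuous (Function.uncurry Γ)
  nonneg : ∀ t x, 0 ≤ U t x
  bdd : ∃ M, ∀ t x, U t x ≤ M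
  far : ∃ R, ∀ t x, R ≤ x → c ≤ Γ t x
  start : c ≤ Γ 0 x₀

variable {U Γ : ℝ → ℝ → ℝ} {c x₀ : ℝ}

/-- An affine strict subsolution cannot cross an affine strict supersolution upwards. -/
theorem affine_le_affine {s t a b m k : ℝ} (hst : s ≤ t) (hab : a ≤ b)
    (hm : ∀ r ∈ Icc s t, m < U r (a + m * (r - s)))
    (hk : ∀ r ∈ Icc s t, U r (b + k * (r - s)) < k) :
    a + m * (t - s) ≤ b + k * (t - s) := by
  by_contra! h
  have hpos : 0 < (m - k) * (t - s) := by nlinarith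
  have hts : 0 < t - s := by
    rcases hst.eq_or_lt with h' | h'
    · simp [h'] at hpos
    · linarith
  have hmk : 0 < m - k := by
    by_contra! h'
    nlinarith
  -- The time at which the two lines meet: there `hm` and `hk` evaluate `U` at the same point and
  -- force `m < k`.
  have hr : s + (b - a) / (m - k) ∈ Icc s t := by
    constructor
    · have := div_nonneg (sub_nonneg.2 hab) hmk.le
      linarith
    · have : (b - a) / (m - k) ≤ t - s := by
        rw [div_le_iff₀ hmk]
        nlinarith
      linarith
  have h1 := hm _ hr
  have h2 := hk _ hr
  have e : a + m * (s + (b - a) / (m - k) - s) = b + k * (s + (b - a) / (m - k) - s) := by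
    field_simp
    ring
  rw [e] at h1
  linarith

/-- As `U ≥ 0`, every line of negative slope is a strict subsolution; the one used here ends halfway
between `f t` and `f s`. -/
theorem IsUpper.mono {f : ℝ → ℝ} (hf : IsUpper U Γ c x₀ f) (hU : ∀ t x, 0 ≤ U t x) {s t : ℝ}
    (hs : 0 ≤ s) (hst : s ≤ t) : f s ≤ f t := by
  rcases hst.eq_or_lt with rfl | h
  · rfl
  by_contra! hlt
  have hts : 0 < t - s := sub_pos.2 h
  have hneg : (f t - f s) / 2 / (t - s) < 0 := div_neg_of_neg_of_pos (by linarith) hts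
  have := hf.growth s t (f s) ((f t - f s) / 2 / (t - s)) hs hst
    (fun r _ => hneg.trans_le (hU _ _)) le_rfl
  rw [div_mul_cancel₀ _ hts.ne'] at this
  linarith

theorem IsRegular.exists_isUpper (h : IsRegular U Γ c x₀) : ∃ f, IsUpper U Γ c x₀ f := by
  obtain ⟨M, hM⟩ := h.bdd
  obtain ⟨R, hR⟩ := h.far
  have hM0 : 0 ≤ M := (h.nonneg 0 0).trans (hM 0 0)
  refine ⟨fun t => max R x₀ + (M + 1) * t, by simp, fun t ht => hR _ _ ?_, ?_⟩
  · have := le_max_left R x₀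
    nlinarith [mul_nonneg (by linarith : 0 ≤ M + 1) ht]
  · intro s t a m hs hst hm ha
    refine (affine_le_affine hst ha hm (k := M + 1) fun r _ => by linarith [hM r (max R x₀ +
      (M + 1) * s + (M + 1) * (r - s))]).trans_eq (by ring)

theorem minUpper_of_nonneg {t : ℝ} (ht : 0 ≤ t) :
    minUpper U Γ c x₀ t = sInf ((fun f : ℝ → ℝ => f t) '' {f | IsUpper U Γ c x₀ f}) := by
  simp [minUpper, max_eq_left ht]

theorem IsRegular.minUpper_le (h : IsRegular U Γ c x₀) {f : ℝ → ℝ} (hf : IsUpper U Γ c x₀ f)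
    {t : ℝ} (ht : 0 ≤ t) : minUpper U Γ c x₀ t ≤ f t := by
  rw [minUpper_of_nonneg ht]
  refine csInf_le ⟨x₀, ?_⟩ ⟨f, hf, rfl⟩
  rintro _ ⟨g, hg, rfl⟩
  exact hg.init.trans (hg.mono h.nonneg le_rfl ht)

theorem IsRegular.le_minUpper (h : IsRegular U Γ c x₀) {t b : ℝ} (ht : 0 ≤ t)
    (hb : ∀ f, IsUpper U Γ c x₀ f → b ≤ f t) : b ≤ minUpper U Γ c x₀ t := by
  rw [minUpper_of_nonneg ht]
  obtain ⟨f, hf⟩ := h.exists_isUpper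
  refine le_csInf ⟨_, f, hf, rfl⟩ ?_
  rintro _ ⟨g, hg, rfl⟩
  exact hb g hg

/-- The admissible set at a fixed time is closed, so it contains the infimum; the growth condition
bounds from below, and its hypothesis passes from the infimum to each competitor. -/
theorem IsRegular.isUpper_minUpper (h : IsRegular U Γ c x₀) :
    IsUpper U Γ c x₀ (minUpper U Γ c x₀) := by
  refine ⟨h.le_minUpper le_rfl fun f hf => hf.init, fun t ht => ?_, ?_⟩
  · obtain ⟨f, hf⟩ := h.exists_isUpper
    have hcl : IsClosed {x | c ≤ Γ t x} :=
      isClosed_le continuous_const (h.contΓ.comp (Continuous.prodMk_right t))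
    have hsub : (fun f : ℝ → ℝ => f t) '' {f | IsUpper U Γ c x₀ f} ⊆ {x | c ≤ Γ t x} := by
      rintro _ ⟨g, hg, rfl⟩
      exact hg.constr t ht
    rw [minUpper_of_nonneg ht]
    refine hcl.closure_subset_iff.2 hsub (csInf_mem_closure ⟨_, f, hf, rfl⟩ ⟨x₀, ?_⟩)
    rintro _ ⟨g, hg, rfl⟩
    exact hg.init.trans (hg.mono h.nonneg le_rfl ht)
  · intro s t a m hs hst hm ha
    exact h.le_minUpper (hs.trans hst) fun f hf =>
      hf.growth s t a m hs hst hm (ha.trans (h.minUpper_le hf hs))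

theorem IsRegular.monotone_minUpper (h : IsRegular U Γ c x₀) : Monotone (minUpper U Γ c x₀) := by
  intro s t hst
  have e : ∀ t, minUpper U Γ c x₀ t = minUpper U Γ c x₀ (max t 0) := by simp [minUpper]
  rw [e s, e t]
  exact h.isUpper_minUpper.mono h.nonneg (le_max_right _ _) (max_le_max_right _ hst)

/-- Comparison principle: lowering the minimal upper function on a set `J` to a function `q` that is
admissible there and not crossed by affine strict subsolutions is impossible. -/
theorem IsRegular.minUpper_le_of_modification (h : IsRegular U Γ c x₀) {J : Set ℝ} {q : ℝ → ℝ}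
    (h0 : 0 ∈ J → x₀ ≤ q 0) (hc : ∀ t ∈ J, c ≤ Γ t (q t))
    (hq : ∀ s t a m, 0 ≤ s → s ≤ t → t ∈ J → (∀ r ∈ Icc s t, m < U r (a + m * (r - s))) →
      a ≤ minUpper U Γ c x₀ s → (s ∈ J → a ≤ q s) → a + m * (t - s) ≤ q t)
    {t : ℝ} (ht : 0 ≤ t) (htJ : t ∈ J) : minUpper U Γ c x₀ t ≤ q t := by
  classical
  have hL := h.isUpper_minUpper
  have hf : IsUpper U Γ c x₀
      (fun t => if t ∈ J then min (minUpper U Γ c x₀ t) (q t) else minUpper U Γ c x₀ t) := by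
    refine ⟨?_, fun t ht => ?_, ?_⟩
    · split_ifs with hJ
      · exact le_min hL.init (h0 hJ)
      · exact hL.init
    · split_ifs with hJ
      · rcases min_choice (minUpper U Γ c x₀ t) (q t) with e | e <;> rw [e]
        · exact hL.constr t ht
        · exact hc t hJ
      · exact hL.constr t ht
    · intro s t a m hs hst hm ha
      have ha1 : a ≤ minUpper U Γ c x₀ s := by
        refine ha.trans ?_
        split_ifs
        · exact min_le_left _ _
        · rfl
      have ha2 : s ∈ J → a ≤ q s := fun hJ => by
        rw [if_pos hJ] at ha
        exact ha.trans (min_le_right _ _)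
      have h1 := hL.growth s t a m hs hst hm ha1
      split_ifs with hJ
      · exact le_min h1 (hq s t a m hs hst hJ hm ha1 ha2)
      · exact h1
  have := h.minUpper_le hf ht
  rw [if_pos htJ] at this
  exact this.trans (min_le_right _ _)

theorem IsRegular.minUpper_zero (h : IsRegular U Γ c x₀) : minUpper U Γ c x₀ 0 = x₀ := by
  refine le_antisymm ?_ h.isUpper_minUpper.init
  refine h.minUpper_le_of_modification (J := {0}) (q := fun _ => x₀) (fun _ => le_rfl) ?_ ?_ le_rfl
    rfl
  · rintro t rfl
    exact h.start
  · rintro s t a m hs hst rfl - - h2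
    obtain rfl : s = 0 := le_antisymm hst hs
    simpa using h2 rfl

theorem IsRegular.minUpper_of_nonpos (h : IsRegular U Γ c x₀) {t : ℝ} (ht : t ≤ 0) :
    minUpper U Γ c x₀ t = x₀ := by
  refine Eq.trans ?_ h.minUpper_zero
  simp [minUpper, ht]

theorem IsRegular.le_minUpper' (h : IsRegular U Γ c x₀) (t : ℝ) : x₀ ≤ minUpper U Γ c x₀ t := by
  rcases le_total t 0 with ht | ht
  · exact (h.minUpper_of_nonpos ht).ge
  · exact h.minUpper_zero.ge.trans (h.monotone_minUpper ht)

/-- Replacing the value at the single time `t` by the left limit keeps an upper function, so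
minimality rules out a jump at `t` from the left. -/
theorem IsRegular.tendsto_left (h : IsRegular U Γ c x₀) (t : ℝ) :
    Tendsto (minUpper U Γ c x₀) (𝓝[<] t) (𝓝 (minUpper U Γ c x₀ t)) := by
  rcases le_or_gt t 0 with ht | ht
  · rw [h.minUpper_of_nonpos ht]
    refine tendsto_const_nhds.congr' ?_
    filter_upwards [self_mem_nhdsWithin] with s hs
    exact (h.minUpper_of_nonpos ((mem_Iio.1 hs).le.trans ht)).symm
  set L := minUpper U Γ c x₀ with hLdef
  have hlim := h.monotone_minUpper.tendsto_leftLim t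
  rw [← hLdef] at hlim
  have hpos : ∀ᶠ s in 𝓝[<] t, 0 ≤ s := by
    filter_upwards [Ioo_mem_nhdsLT ht] with s hs using hs.1.le
  have key : L t ≤ Function.leftLim L t := by
    refine h.minUpper_le_of_modification (J := {t}) (q := fun _ => Function.leftLim L t)
      (fun h0 => absurd h0 ht.ne) ?_ ?_ ht.le rfl
    · rintro r rfl
      have h1 : Tendsto (fun s => Γ s (L s)) (𝓝[<] r) (𝓝 (Γ r (Function.leftLim L r))) :=
        (h.contΓ.tendsto (r, Function.leftLim L r)).comp
          ((tendsto_id.mono_left nhdsWithin_le_nhds).prodMk_nhds hlim)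
      refine ge_of_tendsto h1 ?_
      filter_upwards [hpos] with s hs using h.isUpper_minUpper.constr s hs
    · rintro s r a m hs hsr rfl hm ha haJ
      rcases hsr.eq_or_lt with rfl | hlt
      · simpa using haJ rfl
      · have h1 : Tendsto (fun u => a + m * (u - s)) (𝓝[<] r) (𝓝 (a + m * (r - s))) :=
          Tendsto.mono_left (Continuous.tendsto (by fun_prop) r) nhdsWithin_le_nhds
        refine le_of_tendsto_of_tendsto h1 hlim ?_
        filter_upwards [Ioo_mem_nhdsLT hlt] with u hu
        exact h.isUpper_minUpper.growth s u a m hs hu.1.le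
          (fun v hv => hm v ⟨hv.1, hv.2.trans hu.2.le⟩) ha
  have : Function.leftLim L t = L t :=
    le_antisymm (h.monotone_minUpper.leftLim_le le_rfl) key
  rwa [this] at hlim

/-- Lower bound for the growth: the right lower derivative is at least `U`. -/
theorem IsRegular.eventually_ge (h : IsRegular U Γ c x₀) {t₀ m : ℝ} (ht : 0 ≤ t₀)
    (hm : m < U t₀ (minUpper U Γ c x₀ t₀)) :
    ∀ᶠ t in 𝓝[>] t₀, minUpper U Γ c x₀ t₀ + m * (t - t₀) ≤ minUpper U Γ c x₀ t := by
  set x := minUpper U Γ c x₀ t₀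
  have hcont : Continuous fun r => U r (x + m * (r - t₀)) :=
    h.contU.comp (continuous_id.prodMk (by fun_prop))
  have hev : ∀ᶠ r in 𝓝 t₀, m < U r (x + m * (r - t₀)) :=
    hcont.continuousAt.eventually_const_lt (by simpa using hm)
  obtain ⟨η, hη, hball⟩ := Metric.eventually_nhds_iff.1 hev
  filter_upwards [Ioo_mem_nhdsGT (by linarith : t₀ < t₀ + η)] with t htt
  refine h.isUpper_minUpper.growth t₀ t x m ht htt.1.le (fun r hr => hball ?_) le_rfl
  rw [Real.dist_eq, abs_lt]
  constructor <;> linarith [hr.1, hr.2, htt.2]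

/-- Upper bound for the growth: a strictly admissible point above the current position yields an
affine barrier. -/
theorem IsRegular.eventually_le (h : IsRegular U Γ c x₀) {t₀ x m : ℝ} (ht : 0 ≤ t₀)
    (hx : minUpper U Γ c x₀ t₀ ≤ x) (hc : c < Γ t₀ x) (hm : U t₀ x < m) :
    ∀ᶠ t in 𝓝[>] t₀, minUpper U Γ c x₀ t ≤ x + m * (t - t₀) := by
  have hcont : Continuous fun r => U r (x + m * (r - t₀)) :=
    h.contU.comp (continuous_id.prodMk (by fun_prop))
  have hcont' : Continuous fun r => Γ r (x + m * (r - t₀)) :=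
    h.contΓ.comp (continuous_id.prodMk (by fun_prop))
  have hev : ∀ᶠ r in 𝓝 t₀, U r (x + m * (r - t₀)) < m ∧ c < Γ r (x + m * (r - t₀)) :=
    (hcont.continuousAt.eventually_lt_const (by simpa using hm)).and
      (hcont'.continuousAt.eventually_const_lt (by simpa using hc))
  obtain ⟨η, hη, hball⟩ := Metric.eventually_nhds_iff.1 hev
  have hball' : ∀ r ∈ Ico t₀ (t₀ + η), U r (x + m * (r - t₀)) < m ∧ c < Γ r (x + m * (r - t₀)) := by
    intro r hr
    refine hball ?_
    rw [Real.dist_eq, abs_lt]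
    constructor <;> linarith [hr.1, hr.2]
  filter_upwards [Ioo_mem_nhdsGT (by linarith : t₀ < t₀ + η)] with t htt
  refine h.minUpper_le_of_modification (J := Ioo t₀ (t₀ + η)) (q := fun r => x + m * (r - t₀))
    (fun h0 => absurd h0.1 ht.not_gt) (fun r hr => (hball' r ⟨hr.1.le, hr.2⟩).2.le) ?_
    (ht.trans htt.1.le) htt
  intro s r a k hs hsr hr hk ha haJ
  -- If the subsolution starts inside `J`, it is compared with the barrier directly; if it starts at
  -- or before `t₀`, it is below the minimal function at `t₀`, hence below the barrier there.
  rcases lt_or_ge t₀ s with hlt | hge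
  · have h1 := haJ ⟨hlt, hsr.trans_lt hr.2⟩
    refine (affine_le_affine (U := U) (k := m) hsr h1 hk fun v hv => ?_).trans_eq (by ring)
    have := (hball' v ⟨hlt.le.trans hv.1, hv.2.trans_lt hr.2⟩).1
    convert this using 2
    ring
  · have h1 := h.isUpper_minUpper.growth s t₀ a k hs hge
      (fun v hv => hk v ⟨hv.1, hv.2.trans hr.1.le⟩) ha
    have h2 := affine_le_affine (U := U) (m := k) (k := m) hr.1.le (h1.trans hx)
      (fun v hv => by
        have := hk v ⟨hge.trans hv.1, hv.2⟩
        convert this using 2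
        ring)
      (fun v hv => (hball' v ⟨hv.1, hv.2.trans_lt hr.2⟩).1)
    linarith

/-- Jumps only take place across points where the constraint is not strictly satisfied. -/
theorem IsRegular.rightLim_le (h : IsRegular U Γ c x₀) {t₀ x : ℝ} (ht : 0 ≤ t₀)
    (hx : minUpper U Γ c x₀ t₀ ≤ x) (hc : c < Γ t₀ x) :
    Function.rightLim (minUpper U Γ c x₀) t₀ ≤ x := by
  have h1 : Tendsto (fun t => x + (U t₀ x + 1) * (t - t₀)) (𝓝[>] t₀)
      (𝓝 (x + (U t₀ x + 1) * (t₀ - t₀))) :=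
    Tendsto.mono_left (Continuous.tendsto (by fun_prop) t₀) nhdsWithin_le_nhds
  have := le_of_tendsto_of_tendsto (h.monotone_minUpper.tendsto_rightLim t₀) h1
    (h.eventually_le ht hx hc (lt_add_one _))
  simpa using this

/-- A strictly admissible point inside the jump would stop it; the top end follows by continuity of
`Γ t₀` from below. -/
theorem IsRegular.constraint_le_of_mem (h : IsRegular U Γ c x₀) {t₀ x : ℝ} (ht : 0 ≤ t₀)
    (h0 : Γ t₀ (minUpper U Γ c x₀ t₀) ≤ c)
    (hx : x ∈ Icc (minUpper U Γ c x₀ t₀) (Function.rightLim (minUpper U Γ c x₀) t₀)) :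
    Γ t₀ x ≤ c := by
  rcases hx.1.eq_or_lt with rfl | hlt
  · exact h0
  have h1 : Tendsto (fun y => Γ t₀ y) (𝓝[<] x) (𝓝 (Γ t₀ x)) :=
    ((h.contΓ.comp (Continuous.prodMk_right t₀)).tendsto x).mono_left nhdsWithin_le_nhds
  refine le_of_tendsto h1 ?_
  filter_upwards [Ioo_mem_nhdsLT hlt] with y hy
  by_contra! hcon
  linarith [h.rightLim_le ht hy.1.le hcon, hx.2, hy.2]

theorem IsRegular.rightLim_eq_of_lt (h : IsRegular U Γ c x₀) {t₀ : ℝ} (ht : 0 ≤ t₀)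
    (hc : c < Γ t₀ (minUpper U Γ c x₀ t₀)) :
    Function.rightLim (minUpper U Γ c x₀) t₀ = minUpper U Γ c x₀ t₀ :=
  le_antisymm (h.rightLim_le ht le_rfl hc) (h.monotone_minUpper.le_rightLim le_rfl)

theorem IsRegular.constraint_rightLim (h : IsRegular U Γ c x₀) {t₀ : ℝ} (ht : 0 ≤ t₀) :
    Γ t₀ (Function.rightLim (minUpper U Γ c x₀) t₀) = Γ t₀ (minUpper U Γ c x₀ t₀) := by
  rcases lt_or_ge c (Γ t₀ (minUpper U Γ c x₀ t₀)) with hc | hc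
  · rw [h.rightLim_eq_of_lt ht hc]
  · refine (le_antisymm (h.constraint_le_of_mem ht hc
      ⟨h.monotone_minUpper.le_rightLim le_rfl, le_rfl⟩) ?_).trans
      (le_antisymm hc (h.isUpper_minUpper.constr t₀ ht)).symm
    have h1 : Tendsto (fun s => Γ s (minUpper U Γ c x₀ s)) (𝓝[>] t₀)
        (𝓝 (Γ t₀ (Function.rightLim (minUpper U Γ c x₀) t₀))) :=
      (h.contΓ.tendsto (t₀, Function.rightLim (minUpper U Γ c x₀) t₀)).comp
        ((tendsto_id.mono_left nhdsWithin_le_nhds).prodMk_nhds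
          (h.monotone_minUpper.tendsto_rightLim t₀))
    refine ge_of_tendsto h1 ?_
    filter_upwards [self_mem_nhdsWithin] with s hs
    exact h.isUpper_minUpper.constr s (ht.trans (mem_Ioi.1 hs).le)

/-- The constraint is continuous along the minimal upper function. -/
theorem IsRegular.continuousOn_constraint (h : IsRegular U Γ c x₀) :
    ContinuousOn (fun t => Γ t (minUpper U Γ c x₀ t)) (Ici 0) := by
  intro t ht
  refine ContinuousAt.continuousWithinAt ?_
  rw [continuousAt_iff_continuous_left'_right']
  refine ⟨(h.contΓ.tendsto (t, minUpper U Γ c x₀ t)).comp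
    ((tendsto_id.mono_left nhdsWithin_le_nhds).prodMk_nhds (h.tendsto_left t)), ?_⟩
  have h1 := (h.contΓ.tendsto (t, Function.rightLim (minUpper U Γ c x₀) t)).comp
    ((tendsto_id.mono_left nhdsWithin_le_nhds).prodMk_nhds
      (h.monotone_minUpper.tendsto_rightLim t))
  simp only [Function.uncurry_apply_pair, h.constraint_rightLim ht] at h1
  exact h1

theorem IsRegular.continuousAt_of_lt (h : IsRegular U Γ c x₀) {t : ℝ} (ht : 0 ≤ t)
    (hc : c < Γ t (minUpper U Γ c x₀ t)) : ContinuousAt (minUpper U Γ c x₀) t := by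
  rw [continuousAt_iff_continuous_left'_right']
  refine ⟨h.tendsto_left t, ?_⟩
  have := h.monotone_minUpper.tendsto_rightLim t
  rwa [h.rightLim_eq_of_lt ht hc] at this

theorem IsRegular.hasDerivWithinAt_of_lt (h : IsRegular U Γ c x₀) {t : ℝ} (ht : 0 ≤ t)
    (hc : c < Γ t (minUpper U Γ c x₀ t)) :
    HasDerivWithinAt (minUpper U Γ c x₀) (U t (minUpper U Γ c x₀ t)) (Ioi t) t := by
  rw [hasDerivWithinAt_iff_tendsto_slope' (by simp), tendsto_order]
  constructor
  · intro m hm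
    obtain ⟨k, hk1, hk2⟩ := exists_between hm
    filter_upwards [h.eventually_ge ht hk2, self_mem_nhdsWithin] with s hs hst
    refine hk1.trans_le ?_
    rw [slope_def_field, le_div_iff₀ (sub_pos.2 hst)]
    linarith
  · intro m hm
    obtain ⟨k, hk1, hk2⟩ := exists_between hm
    filter_upwards [h.eventually_le ht le_rfl hc hk1, self_mem_nhdsWithin] with s hs hst
    refine lt_of_le_of_lt ?_ hk2
    rw [slope_def_field, div_le_iff₀ (sub_pos.2 hst)]
    linarith

theorem IsRegular.le_deriv (h : IsRegular U Γ c x₀) {t : ℝ} (ht : 0 ≤ t)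
    (hd : DifferentiableAt ℝ (minUpper U Γ c x₀) t) :
    U t (minUpper U Γ c x₀ t) ≤ deriv (minUpper U Γ c x₀) t := by
  have h1 := hd.hasDerivAt.hasDerivWithinAt (s := Ioi t)
  rw [hasDerivWithinAt_iff_tendsto_slope' (by simp)] at h1
  refine le_of_forall_lt fun m hm => ?_
  obtain ⟨k, hk1, hk2⟩ := exists_between hm
  refine hk1.trans_le (ge_of_tendsto h1 ?_)
  filter_upwards [h.eventually_ge ht hk2, self_mem_nhdsWithin] with s hs hst
  rw [slope_def_field, le_div_iff₀ (sub_pos.2 hst)]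
  linarith

theorem IsRegular.deriv_eq_of_lt (h : IsRegular U Γ c x₀) {t : ℝ} (ht : 0 ≤ t)
    (hd : DifferentiableAt ℝ (minUpper U Γ c x₀) t) (hc : c < Γ t (minUpper U Γ c x₀ t)) :
    deriv (minUpper U Γ c x₀) t = U t (minUpper U Γ c x₀ t) :=
  (uniqueDiffWithinAt_Ioi t).eq_deriv _ hd.hasDerivAt.hasDerivWithinAt
    (h.hasDerivWithinAt_of_lt ht hc)

/-- Where the constraint is strictly satisfied, the minimal upper function has no singular part. -/
theorem IsRegular.sub_eq_integral_deriv (h : IsRegular U Γ c x₀) {a b : ℝ} (ha : 0 ≤ a)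
    (hab : a ≤ b) (hc : ∀ t ∈ Icc a b, c < Γ t (minUpper U Γ c x₀ t)) :
    minUpper U Γ c x₀ b - minUpper U Γ c x₀ a = ∫ t in a..b, deriv (minUpper U Γ c x₀) t := by
  have hcont : ContinuousOn (minUpper U Γ c x₀) (uIcc a b) := by
    rw [uIcc_of_le hab]
    exact fun t ht => (h.continuousAt_of_lt (ha.trans ht.1) (hc t ht)).continuousWithinAt
  have hint : IntervalIntegrable (fun t => U t (minUpper U Γ c x₀ t)) volume a b :=
    (h.contU.comp_continuousOn (continuousOn_id.prodMk hcont)).intervalIntegrable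
  -- For a continuous function the right derivative, known at every point, suffices for the
  -- fundamental theorem of calculus.
  rw [← intervalIntegral.integral_eq_sub_of_hasDeriv_right hcont ?_ hint]
  · refine intervalIntegral.integral_congr_ae ?_
    filter_upwards [h.monotone_minUpper.ae_differentiableAt] with t hd ht
    rw [uIoc_of_le hab] at ht
    exact (h.deriv_eq_of_lt (ha.trans ht.1.le) hd (hc t ⟨ht.1.le, ht.2⟩)).symm
  · intro t ht
    rw [min_eq_left hab, max_eq_right hab] at ht
    exact h.hasDerivWithinAt_of_lt (ha.trans ht.1.le) (hc t ⟨ht.1.le, ht.2.le⟩)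

end Minimal

/-! ### Singular functionals as limits of difference quotients. -/

section Singular

open Filter Topology

theorem ae_abs_le_norm {T : ℝ} (φ : Linf T) : ∀ᵐ t ∂(vol T), |φ t| ≤ ‖φ‖ := by
  filter_upwards [ae_le_eLpNormEssSup (f := φ) (μ := vol T)] with t ht
  rw [Lp.norm_def, eLpNorm_exponent_top, ← Real.norm_eq_abs]
  have hfin : eLpNormEssSup φ (vol T) ≠ ⊤ := by
    rw [← eLpNorm_exponent_top]
    exact Lp.eLpNorm_ne_top φ
  rw [← toReal_enorm]
  exact ENNReal.toReal_mono hfin ht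

theorem integrable_mul_Linf {T : ℝ} {g : ℝ → ℝ} (hg : Integrable g (vol T)) (φ : Linf T) :
    Integrable (fun t => g t * φ t) (vol T) :=
  hg.mul_bdd (Lp.aestronglyMeasurable φ) (ae_abs_le_norm φ)

/-- The functional on `L^∞(0,T)` given by integration against `g ∈ L^1(0,T)`. -/
noncomputable def integralDual {T : ℝ} (g : ℝ → ℝ) (hg : Integrable g (vol T)) : LinfDual T :=
  LinearMap.mkContinuous
    { toFun := fun φ => ∫ t, g t * φ t ∂(vol T)
      map_add' := fun φ ψ => by
        rw [← integral_add (integrable_mul_Linf hg φ) (integrable_mul_Linf hg ψ)]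
        refine integral_congr_ae ?_
        filter_upwards [Lp.coeFn_add φ ψ] with t ht
        rw [ht, Pi.add_apply, mul_add]
      map_smul' := fun a φ => by
        rw [RingHom.id_apply, smul_eq_mul, ← integral_const_mul]
        refine integral_congr_ae ?_
        filter_upwards [Lp.coeFn_smul a φ] with t ht
        rw [ht, Pi.smul_apply, smul_eq_mul]
        ring }
    (∫ t, |g t| ∂(vol T)) (fun φ => by
      rw [LinearMap.coe_mk, AddHom.coe_mk, ← integral_mul_const]
      refine norm_integral_le_of_norm_le (hg.abs.mul_const _) ?_
      filter_upwards [ae_abs_le_norm φ] with t ht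
      rw [norm_mul, Real.norm_eq_abs, Real.norm_eq_abs]
      exact mul_le_mul_of_nonneg_left ht (abs_nonneg _))

theorem integralDual_apply {T : ℝ} {g : ℝ → ℝ} (hg : Integrable g (vol T)) (φ : Linf T) :
    integralDual g hg φ = ∫ t, g t * φ t ∂(vol T) := rfl

theorem norm_integralDual_le {T : ℝ} {g : ℝ → ℝ} (hg : Integrable g (vol T)) :
    ‖integralDual g hg‖ ≤ ∫ t, |g t| ∂(vol T) :=
  LinearMap.mkContinuous_norm_le _ (integral_nonneg fun _ => abs_nonneg _) _

/-- A bounded sequence of functionals converges pointwise along an ultrafilter. -/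
theorem exists_tendsto_hyperfilter {E : Type*} [NormedAddCommGroup E] [NormedSpace ℝ E]
    (m : ℕ → StrongDual ℝ E) (C : ℝ) (hm : ∀ n, ‖m n‖ ≤ C) :
    ∃ μ : StrongDual ℝ E, ∀ φ, Tendsto (fun n => m n φ) (hyperfilter ℕ) (𝓝 (μ φ)) := by
  -- Banach–Alaoglu. An ultrafilter replaces a subsequence, since the dual ball of a nonseparable
  -- space such as L^∞ need not be weak-* sequentially compact.
  obtain ⟨μ, -, hμ⟩ := (WeakDual.isCompact_closedBall (𝕜 := ℝ) (E := E) 0 C).ultrafilter_le_nhds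
    ((hyperfilter ℕ).map fun n => StrongDual.toWeakDual (m n))
    (by
      rw [le_principal_iff]
      refine Filter.mem_map.2 (Filter.univ_mem' fun n => ?_)
      exact mem_closedBall_zero_iff.2 (hm n))
  have hlim : Tendsto (fun n => StrongDual.toWeakDual (m n)) (hyperfilter ℕ) (𝓝 μ) := hμ
  refine ⟨WeakDual.toStrongDual μ, fun φ => ?_⟩
  exact ((WeakDual.eval_continuous φ).tendsto μ).comp hlim

/-- The backward difference quotient of `v` with step `1/(n+1)`. -/
noncomputable def backwardSlope (v : ℝ → ℝ) (n : ℕ) (s : ℝ) : ℝ :=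
  (n + 1) * (v s - v (s - 1 / (n + 1)))

variable {T : ℝ} {v : ℝ → ℝ}

theorem backwardSlope_nonneg (hv : Monotone v) (n : ℕ) (s : ℝ) : 0 ≤ backwardSlope v n s := by
  have : (0 : ℝ) < n + 1 := n.cast_add_one_pos
  exact mul_nonneg this.le (sub_nonneg.2 (hv (by simp; positivity)))

theorem Monotone.comp_sub_const (hv : Monotone v) (h : ℝ) : Monotone fun s => v (s - h) :=
  fun _ _ hst => hv (by linarith)

theorem intervalIntegrable_backwardSlope (hv : Monotone v) (n : ℕ) (a b : ℝ) :
    IntervalIntegrable (backwardSlope v n) volume a b :=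
  (hv.intervalIntegrable.sub (Monotone.comp_sub_const hv _).intervalIntegrable).const_mul _

theorem integrable_backwardSlope (hT : 0 ≤ T) (hv : Monotone v) (n : ℕ) :
    Integrable (backwardSlope v n) (vol T) :=
  ((intervalIntegrable_iff_integrableOn_Ioo_of_le hT).1
    (intervalIntegrable_backwardSlope hv n 0 T))

/-- The integral telescopes to the mean of `v` over a window ending at `T` minus its mean over a
window ending at `0`; steps are at most `1`, whence `v (-1)`. -/
theorem integral_backwardSlope_le (hT : 0 ≤ T) (hv : Monotone v) (n : ℕ) :
    ∫ t, backwardSlope v n t ∂(vol T) ≤ v T - v (-1) := by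
  have hn : (0 : ℝ) < n + 1 := n.cast_add_one_pos
  set h : ℝ := 1 / (n + 1) with hh
  have hpos : 0 < h := by positivity
  have hle : h ≤ 1 := by
    rw [hh, div_le_one hn]
    linarith [n.cast_nonneg (α := ℝ)]
  rw [← integral_Ioc_eq_integral_Ioo, ← intervalIntegral.integral_of_le hT]
  unfold backwardSlope
  rw [intervalIntegral.integral_const_mul, intervalIntegral.integral_sub hv.intervalIntegrable
    (Monotone.comp_sub_const hv _).intervalIntegrable, ← hh,
    intervalIntegral.integral_comp_sub_right (fun s => v s) h,
    intervalIntegral.integral_interval_sub_interval_comm' hv.intervalIntegrable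
      hv.intervalIntegrable hv.intervalIntegrable]
  have h1 : ∫ x in (T - h)..T, v x ≤ ∫ _x in (T - h)..T, v T :=
    intervalIntegral.integral_mono_on (by linarith) hv.intervalIntegrable (by simp)
      fun x hx => hv hx.2
  have h2 : ∫ _x in (0 - h)..0, v (-1) ≤ ∫ x in (0 - h)..0, v x :=
    intervalIntegral.integral_mono_on (by linarith) (by simp) hv.intervalIntegrable
      fun x hx => hv (by linarith [hx.1])
  simp only [intervalIntegral.integral_const, smul_eq_mul] at h1 h2
  calc (n + 1) * ((∫ x in (T - h)..T, v x) - ∫ x in (0 - h)..0, v x)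
      ≤ (n + 1) * (h * (v T - v (-1))) := by
        refine mul_le_mul_of_nonneg_left ?_ hn.le
        linarith
    _ = v T - v (-1) := by
        rw [hh]
        field_simp

/-- A translation moves the difference quotient onto `φ`, where dominated convergence applies. -/
theorem tendsto_integral_backwardSlope_mul (hv : Monotone v) {φ : ℝ → ℝ}
    (hφ : IsTestFunction T φ) :
    Tendsto (fun n => ∫ t, backwardSlope v n t * φ t ∂(vol T)) atTop
      (𝓝 (-∫ t, v t * deriv φ t ∂(vol T))) := by
  have hφ0 : ∀ t, t ∉ Ioo 0 T → φ t = 0 := fun t ht =>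
    image_eq_zero_of_notMem_tsupport fun h => ht (hφ.support h)
  have hdφ0 : ∀ t, t ∉ Ioo 0 T → deriv φ t = 0 := fun t ht =>
    image_eq_zero_of_notMem_tsupport fun h => ht (hφ.support (tsupport_deriv_subset h))
  have hint : ∀ {ψ : ℝ → ℝ} {u : ℝ → ℝ}, Continuous ψ → HasCompactSupport ψ → Monotone u →
      Integrable (fun t => u t * ψ t) := fun hψ hc hu =>
    (hu.locallyIntegrable).integrable_smul_right_of_hasCompactSupport hψ hc
  have hφc := hφ.smooth.continuous
  obtain ⟨C, hC⟩ := hφ.smooth.lipschitzWith_of_hasCompactSupport hφ.compact (by simp)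
  have hshift : ∀ n : ℕ, ∫ t, backwardSlope v n t * φ t ∂(vol T) =
      ∫ t, v t * (-((n + 1) * (φ (t + 1 / (n + 1)) - φ t))) := by
    intro n
    set h : ℝ := 1 / (n + 1)
    have hc' : HasCompactSupport fun t => φ (t + h) :=
      hφ.compact.comp_homeomorph (Homeomorph.addRight h)
    rw [setIntegral_eq_integral_of_forall_compl_eq_zero fun t ht => by rw [hφ0 t ht, mul_zero]]
    have e1 : ∫ t, v (t - h) * φ t = ∫ t, v t * φ (t + h) := by
      rw [← integral_add_right_eq_self (fun t => v (t - h) * φ t) h]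
      simp
    calc ∫ t, backwardSlope v n t * φ t
        = ∫ t, (n + 1) * (v t * φ t - v (t - h) * φ t) := by
          congr 1 with t
          simp only [backwardSlope]
          ring
      _ = (n + 1) * ((∫ t, v t * φ t) - ∫ t, v t * φ (t + h)) := by
          rw [integral_const_mul, integral_sub (hint hφc hφ.compact hv)
            (hint hφc hφ.compact (Monotone.comp_sub_const hv h)), e1]
      _ = ∫ t, v t * (-((n + 1) * (φ (t + h) - φ t))) := by
          rw [← integral_sub (hint hφc hφ.compact hv)
            (hint (ψ := fun t => φ (t + h)) (by fun_prop) hc' hv), ← integral_const_mul]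
          congr 1 with t
          ring
  have hlim : -∫ t, v t * deriv φ t ∂(vol T) = ∫ t, v t * (-deriv φ t) := by
    rw [setIntegral_eq_integral_of_forall_compl_eq_zero fun t ht => by rw [hdφ0 t ht, mul_zero],
      ← integral_neg]
    simp
  simp_rw [hshift, hlim]
  have hstep : Tendsto (fun n : ℕ => (1 : ℝ) / (n + 1)) atTop (𝓝[>] 0) :=
    tendsto_nhdsWithin_iff.2 ⟨tendsto_one_div_add_atTop_nhds_zero_nat,
      Eventually.of_forall fun n => by simp only [mem_Ioi]; positivity⟩
  -- Steps are at most `1`, so the shifted test functions live in `[-1, T]`; `C` is a Lipschitz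
  -- constant of `φ`.
  refine tendsto_integral_of_dominated_convergence
    ((Icc (-1) T).indicator fun t => |v t| * C) (fun n => ?_) ?_ (fun n => ?_) ?_
  · refine hv.measurable.aestronglyMeasurable.mul (Continuous.aestronglyMeasurable ?_)
    fun_prop
  · rw [integrable_indicator_iff measurableSet_Icc]
    exact ((hv.locallyIntegrable.integrableOn_isCompact isCompact_Icc).abs).mul_const _
  · refine Eventually.of_forall fun t => ?_
    have hn : (0 : ℝ) < n + 1 := n.cast_add_one_pos
    have hle : (1 : ℝ) / (n + 1) ≤ 1 := by
      rw [div_le_one hn]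
      linarith [n.cast_nonneg (α := ℝ)]
    have hp : (0 : ℝ) < 1 / (n + 1) := by positivity
    by_cases ht : t ∈ Icc (-1) T
    · rw [indicator_of_mem ht, norm_mul, Real.norm_eq_abs, norm_neg, norm_mul]
      refine mul_le_mul_of_nonneg_left ?_ (abs_nonneg _)
      have := hC.norm_sub_le (t + 1 / (n + 1)) t
      rw [add_sub_cancel_left, Real.norm_of_nonneg hp.le] at this
      rw [Real.norm_of_nonneg hn.le]
      calc (n + 1) * ‖φ (t + 1 / (n + 1)) - φ t‖ ≤ (n + 1) * (C * (1 / (n + 1))) := by gcongr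
        _ = C := by field_simp
    · rw [indicator_of_notMem ht, hφ0 t fun h => ht ⟨by linarith [h.1], h.2.le⟩,
        hφ0 (t + 1 / (n + 1)) fun h => ht ⟨by linarith [h.1], by linarith [h.2]⟩]
      simp
  · refine Eventually.of_forall fun t => ?_
    have hd : HasDerivAt φ (deriv φ t) t :=
      (hφ.smooth.differentiable (by simp) t).hasDerivAt
    have h1 := (hasDerivAt_iff_tendsto_slope_zero.1 hd).comp
      (hstep.mono_right (nhdsWithin_mono _ fun x hx => (mem_Ioi.1 hx).ne'))
    refine (h1.neg.const_mul (v t)).congr fun n => ?_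
    simp

theorem tendsto_backwardSlope {t : ℝ} (h : HasDerivAt v 0 t) :
    Tendsto (fun n => backwardSlope v n t) atTop (𝓝 0) := by
  have hstep : Tendsto (fun n : ℕ => -((1 : ℝ) / ((n : ℝ) + 1))) atTop (𝓝[≠] 0) :=
    tendsto_nhdsWithin_iff.2 ⟨by simpa only [neg_zero]
      using (tendsto_one_div_add_atTop_nhds_zero_nat (𝕜 := ℝ)).neg,
      Eventually.of_forall fun n => by
        have : (0 : ℝ) < n + 1 := n.cast_add_one_pos
        simp [this.ne']⟩
  refine ((hasDerivAt_iff_tendsto_slope_zero.1 h).comp hstep).congr fun n => ?_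
  simp only [Function.comp, smul_eq_mul, backwardSlope, inv_neg, one_div, inv_inv, ← sub_eq_add_neg]
  ring

theorem tendsto_integral_backwardSlope_of_vanish
    (hT : 0 ≤ T) (hv : Monotone v)
    (hd : ∀ᵐ t ∂(vol T), HasDerivAt v 0 t) (k : ℕ) (φ : Linf T)
    (hφ : ∀ᵐ t ∂(vol T), t ∉ {t | ∀ n ≥ k, backwardSlope v n t ≤ 1} → φ t = 0) :
    Tendsto (fun n => ∫ t, backwardSlope v n t * φ t ∂(vol T)) atTop (𝓝 0) := by
  have hint : Integrable φ (vol T) :=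
    (memLp_one_iff_integrable.1 ((Lp.memLp φ).mono_exponent le_top))
  rw [← integral_zero ℝ ℝ (μ := vol T)]
  refine tendsto_integral_filter_of_dominated_convergence (fun t => |φ t|) ?_ ?_ hint.abs ?_
  · exact Eventually.of_forall fun n =>
      (integrable_mul_Linf (integrable_backwardSlope hT hv n) φ).aestronglyMeasurable
  · filter_upwards [eventually_ge_atTop k] with n hn
    filter_upwards [hφ] with t ht
    rw [norm_mul, Real.norm_of_nonneg (backwardSlope_nonneg hv n t), Real.norm_eq_abs]
    by_cases hmem : t ∈ {t | ∀ n ≥ k, backwardSlope v n t ≤ 1}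
    · exact mul_le_of_le_one_left (abs_nonneg _) (hmem n hn)
    · simp [ht hmem]
  · filter_upwards [hd] with t ht
    simpa using (tendsto_backwardSlope ht).mul_const (φ t)

/-- Where `w > e`, uniform continuity keeps `w` positive on the whole backward window for small
steps, so the slope is zero. Elsewhere the integrand is at most `e` times the slope, whose total
mass is bounded. -/
theorem tendsto_integral_backwardSlope_of_locally_const
    (hT : 0 ≤ T) (hv : Monotone v) (hv0 : ∀ t ≤ 0, v t = v 0) {w : ℝ → ℝ}
    (hw : ContinuousOn w (Icc 0 T)) (hw0 : ∀ t ∈ Icc 0 T, 0 ≤ w t)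
    (hconst : ∀ a b, 0 ≤ a → a ≤ b → b ≤ T → (∀ t ∈ Icc a b, 0 < w t) → v a = v b)
    (φ : Linf T) (hφ : ∀ᵐ t ∂(vol T), φ t = w t) :
    Tendsto (fun n => ∫ t, backwardSlope v n t * φ t ∂(vol T)) atTop (𝓝 0) := by
  have hIoo : ∀ᵐ t ∂(vol T), t ∈ Ioo 0 T := ae_restrict_mem measurableSet_Ioo
  have hC : 0 ≤ v T - v (-1) := sub_nonneg.2 (hv (by linarith))
  rw [Metric.tendsto_atTop]
  intro ε hε
  set e := ε / (v T - v (-1) + 1) with he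
  have hepos : 0 < e := by positivity
  obtain ⟨δ, hδ, hunif⟩ := Metric.uniformContinuousOn_iff.1
    (isCompact_Icc.uniformContinuousOn_of_continuous hw) e hepos
  obtain ⟨N, hN⟩ := (tendsto_one_div_add_atTop_nhds_zero_nat.eventually
    (gt_mem_nhds hδ)).exists_forall_of_atTop
  refine ⟨N, fun n hn => ?_⟩
  have hn0 : (0 : ℝ) < n + 1 := n.cast_add_one_pos
  have hp : (0 : ℝ) < 1 / (n + 1) := by positivity
  have hpt : ∀ᵐ t ∂(vol T), ‖backwardSlope v n t * φ t‖ ≤ backwardSlope v n t * e := by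
    filter_upwards [hφ, hIoo] with t ht htT
    have htT' : t ∈ Icc 0 T := ⟨htT.1.le, htT.2.le⟩
    rw [ht, norm_mul, Real.norm_of_nonneg (backwardSlope_nonneg hv n t),
      Real.norm_of_nonneg (hw0 t htT')]
    rcases le_or_gt (w t) e with hwe | hwe
    · exact mul_le_mul_of_nonneg_left hwe (backwardSlope_nonneg hv n t)
    · have hz : backwardSlope v n t = 0 := by
        have h1 : v (max (t - 1 / (n + 1)) 0) = v t := by
          refine hconst _ _ (le_max_right _ _) (max_le (by linarith) htT.1.le) htT.2.le ?_
          intro s hs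
          have hs1 := (le_max_left _ _).trans hs.1
          have hs2 := (le_max_right _ _).trans hs.1
          have := hunif t htT' s ⟨hs2, hs.2.trans htT.2.le⟩ (by
            rw [Real.dist_eq, abs_lt]
            constructor <;> linarith [hN n hn, hs.2])
          rw [Real.dist_eq, abs_lt] at this
          linarith [this.2]
        have h2 : v (t - 1 / (n + 1)) = v (max (t - 1 / (n + 1)) 0) := by
          rcases le_total (t - 1 / (n + 1)) 0 with h | h
          · rw [max_eq_right h, hv0 _ h]
          · rw [max_eq_left h]
        rw [backwardSlope, h2, h1, sub_self, mul_zero]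
      simp [hz]
  rw [dist_zero_right]
  calc ‖∫ t, backwardSlope v n t * φ t ∂(vol T)‖
      ≤ ∫ t, backwardSlope v n t * e ∂(vol T) :=
        norm_integral_le_of_norm_le ((integrable_backwardSlope hT hv n).mul_const e) hpt
    _ ≤ (v T - v (-1)) * e := by
        rw [integral_mul_const]
        exact mul_le_mul_of_nonneg_right (integral_backwardSlope_le hT hv n) hepos.le
    _ < ε := by
        rw [he, mul_div_assoc', div_lt_iff₀ (by linarith)]
        nlinarith

/-- A nondecreasing function `v` with derivative zero a.e. has a derivative `-μ` in the sense of
distributions for a singular functional `μ ≤ 0` that does not charge continuous functions `w ≥ 0`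
on whose positivity set `v` is locally constant. -/
theorem exists_singular_functional
    (hT : 0 ≤ T) (hv : Monotone v) (hv0 : ∀ t ≤ 0, v t = v 0)
    (hd : ∀ᵐ t ∂(vol T), HasDerivAt v 0 t) :
    ∃ μ : LinfDual T, IsSingular μ ∧ DistribDerivAddEqZero v μ ∧
      (∀ φ : Linf T, (∀ᵐ t ∂(vol T), 0 ≤ φ t) → μ φ ≤ 0) ∧
      ∀ w : ℝ → ℝ, ContinuousOn w (Icc 0 T) → (∀ t ∈ Icc 0 T, 0 ≤ w t) →
        (∀ a b, 0 ≤ a → a ≤ b → b ≤ T → (∀ t ∈ Icc a b, 0 < w t) → v a = v b) →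
        ∀ φ : Linf T, (∀ᵐ t ∂(vol T), φ t = w t) → μ φ = 0 := by
  obtain ⟨ν, hν⟩ := exists_tendsto_hyperfilter
    (fun n => integralDual _ (integrable_backwardSlope hT hv n)) (v T - v (-1)) (fun n => by
      refine (norm_integralDual_le _).trans ?_
      simp_rw [abs_of_nonneg (backwardSlope_nonneg hv n _)]
      exact integral_backwardSlope_le hT hv n)
  simp only [integralDual_apply] at hν
  -- An ordinary limit, where it exists, determines the ultrafilter limit.
  have huniq : ∀ (φ : Linf T) (l : ℝ),
      Tendsto (fun n => ∫ t, backwardSlope v n t * φ t ∂(vol T)) atTop (𝓝 l) → ν φ = l :=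
    fun φ l hl => tendsto_nhds_unique (hν φ) (hl.mono_left Nat.hyperfilter_le_atTop)
  refine ⟨-ν, ?_, ?_, ?_, ?_⟩
  · refine ⟨fun k => {t | ∀ n ≥ k, backwardSlope v n t ≤ 1}, fun k => ?_, ?_, ?_, ?_⟩
    · have hm : ∀ n, Measurable (backwardSlope v n) := fun n =>
        (hv.measurable.sub (Monotone.comp_sub_const hv _).measurable).const_mul _
      have : (fun k => {t | ∀ n ≥ k, backwardSlope v n t ≤ 1}) k =
          ⋂ n, ⋂ (_ : n ≥ k), {t | backwardSlope v n t ≤ 1} := by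
        ext
        simp
      rw [this]
      exact MeasurableSet.iInter fun n => MeasurableSet.iInter fun _ =>
        measurableSet_le (hm n) measurable_const
    · intro k l hkl t ht n hn
      exact ht n (hkl.trans hn)
    · filter_upwards [hd] with t ht
      obtain ⟨N, hN⟩ := ((tendsto_backwardSlope ht).eventually
        (gt_mem_nhds zero_lt_one)).exists_forall_of_atTop
      exact ⟨N, fun n hn => (hN n hn).le⟩
    · intro k φ hφ
      rw [neg_apply, huniq φ 0
        (tendsto_integral_backwardSlope_of_vanish hT hv hd k φ hφ), neg_zero]
  · intro φ hφ
    have h1 := tendsto_integral_backwardSlope_mul hv hφ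
    rw [neg_apply, huniq hφ.memLp.toLp _ (h1.congr fun n => ?_)]
    · ring
    · refine integral_congr_ae ?_
      filter_upwards [hφ.memLp.coeFn_toLp] with t ht
      rw [ht]
  · intro φ hφ
    rw [neg_apply, neg_nonpos]
    refine ge_of_tendsto' (hν φ) fun n => integral_nonneg_of_ae ?_
    filter_upwards [hφ] with t ht
    exact mul_nonneg (backwardSlope_nonneg hv n t) ht
  · intro w hw hw0 hconst φ hφ
    rw [neg_apply, huniq φ 0
      (tendsto_integral_backwardSlope_of_locally_const hT hv hv0 hw hw0 hconst φ hφ), neg_zero]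

end Singular

/-! ### A priori bound by an energy estimate. -/

section Bound

open Filter Topology

variable {U Γ : ℝ → ℝ → ℝ} {c x₀ : ℝ}

/-- Continuous induction for a left-continuous function which may jump downwards. -/
theorem le_of_left_continuous_of_right_step {H ψ : ℝ → ℝ} {T : ℝ} (h0 : H 0 ≤ ψ 0)
    (hleft : ∀ t, Tendsto H (𝓝[<] t) (𝓝 (H t))) (hψ : Continuous ψ)
    (hstep : ∀ t, 0 ≤ t → t < T → H t ≤ ψ t → ∀ᶠ s in 𝓝[>] t, H s ≤ ψ s) :
    ∀ t ∈ Icc 0 T, H t ≤ ψ t := by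
  by_contra! hcon
  obtain ⟨t₁, ht₁, hlt⟩ := hcon
  set B : Set ℝ := {t | t ∈ Icc 0 T ∧ ψ t < H t} with hB
  have hmem : t₁ ∈ B := ⟨ht₁, hlt⟩
  have hbdd : BddBelow B := ⟨0, fun t ht => ht.1.1⟩
  have hτ0 : 0 ≤ sInf B := le_csInf ⟨_, hmem⟩ fun t ht => ht.1.1
  have hτ1 : sInf B ≤ t₁ := csInf_le hbdd hmem
  have hbelow : ∀ s, 0 ≤ s → s < sInf B → H s ≤ ψ s := fun s hs hsτ => by
    by_contra! h
    exact (csInf_le hbdd (⟨⟨hs, (hsτ.le.trans hτ1).trans ht₁.2⟩, h⟩ : s ∈ B)).not_gt hsτ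
  have hτ : H (sInf B) ≤ ψ (sInf B) := by
    rcases hτ0.eq_or_lt with h | h
    · rwa [← h]
    · refine le_of_tendsto_of_tendsto (hleft _) (hψ.continuousAt.mono_left nhdsWithin_le_nhds) ?_
      filter_upwards [Ioo_mem_nhdsLT h] with s hs using hbelow s hs.1.le hs.2
  have hne : sInf B < t₁ := hτ1.lt_of_ne fun h => by
    rw [h] at hτ
    linarith
  obtain ⟨η, hη, hsub⟩ := mem_nhdsGT_iff_exists_Ioo_subset.1
    (hstep _ hτ0 (hne.trans_le ht₁.2) hτ)
  refine (le_csInf ⟨_, hmem⟩ fun t ht => ?_ : η ≤ sInf B).not_gt hη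
  by_contra! h
  rcases (csInf_le hbdd ht).eq_or_lt with h' | h'
  · rw [h'] at hτ
    linarith [ht.2]
  · exact (hsub ⟨h', h⟩ : H t ≤ ψ t).not_gt ht.2

/-- The energy `∫ (Γ(t,σ) - k) dσ` between `x₀` and the position at time `t`. -/
noncomputable def energy (U Γ : ℝ → ℝ → ℝ) (c x₀ k t : ℝ) : ℝ :=
  ∫ σ in x₀..minUpper U Γ c x₀ t, (Γ t σ - k)

theorem IsRegular.continuous_section (h : IsRegular U Γ c x₀) (t : ℝ) : Continuous (Γ t) :=
  h.contΓ.comp (Continuous.prodMk_right t)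

theorem IsRegular.tendsto_energy_left (h : IsRegular U Γ c x₀) (k t : ℝ) :
    Tendsto (energy U Γ c x₀ k) (𝓝[<] t) (𝓝 (energy U Γ c x₀ k t)) := by
  have hG : Continuous fun p : ℝ × ℝ => ∫ σ in x₀..p.2, (Γ p.1 σ - k) :=
    intervalIntegral.continuous_parametric_intervalIntegral_of_continuous
      (f := fun (p : ℝ × ℝ) σ => Γ p.1 σ - k)
      ((h.contΓ.comp (by fun_prop : Continuous fun q : (ℝ × ℝ) × ℝ => (q.1.1, q.2))).sub
        continuous_const) continuous_snd
  exact (hG.tendsto (t, minUpper U Γ c x₀ t)).comp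
    ((tendsto_id.mono_left nhdsWithin_le_nhds).prodMk_nhds (h.tendsto_left t))

/-- The drift of `Γ` in time acts on the length already covered; the newly covered length
contributes at most `B` per unit. -/
theorem IsRegular.energy_le_add (h : IsRegular U Γ c x₀) {k C s t B : ℝ}
    (hst : s ≤ t) (hlip : ∀ x, x₀ ≤ x → Γ t x - Γ s x ≤ C * (t - s))
    (hB : ∀ x ∈ Icc (minUpper U Γ c x₀ s) (minUpper U Γ c x₀ t), Γ t x - k ≤ B) :
    energy U Γ c x₀ k t ≤ energy U Γ c x₀ k s + C * (t - s) * (minUpper U Γ c x₀ s - x₀) +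
      B * (minUpper U Γ c x₀ t - minUpper U Γ c x₀ s) := by
  set L := minUpper U Γ c x₀
  have hi : ∀ r a b, IntervalIntegrable (fun σ => Γ r σ - k) volume a b := fun r a b =>
    ((h.continuous_section r).sub continuous_const).intervalIntegrable _ _
  have e : energy U Γ c x₀ k t = (∫ σ in x₀..L s, (Γ t σ - k)) + ∫ σ in L s..L t, (Γ t σ - k) :=
    (intervalIntegral.integral_add_adjacent_intervals (hi _ _ _) (hi _ _ _)).symm
  have h1 : ∫ σ in x₀..L s, (Γ t σ - k) ≤ ∫ σ in x₀..L s, ((Γ s σ - k) + C * (t - s)) :=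
    intervalIntegral.integral_mono_on (h.le_minUpper' s) (hi _ _ _)
      ((hi _ _ _).add (by simp)) fun x hx => by linarith [hlip x hx.1]
  rw [intervalIntegral.integral_add (hi _ _ _) (by simp), intervalIntegral.integral_const,
    smul_eq_mul] at h1
  have h2 : ∫ σ in L s..L t, (Γ t σ - k) ≤ ∫ _σ in L s..L t, B :=
    intervalIntegral.integral_mono_on (h.monotone_minUpper hst) (hi _ _ _) (by simp) hB
  rw [intervalIntegral.integral_const, smul_eq_mul] at h2
  have h3 : energy U Γ c x₀ k s = ∫ σ in x₀..L s, (Γ s σ - k) := rfl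
  rw [e, h3]
  linarith

/-- A priori bound for the minimal upper function on `[0,T]`. -/
theorem IsRegular.minUpper_lt (h : IsRegular U Γ c x₀) {T δ R C Γmax α β K : ℝ}
    (hc : 0 ≤ c) (hδ : 0 < δ) (hC : 0 ≤ C) (hΓ0 : 0 ≤ Γmax) (hα : 0 ≤ α) (hβ : 0 ≤ β)
    (hlip : ∀ s t x, 0 ≤ s → s ≤ t → x₀ ≤ x → Γ t x - Γ s x ≤ C * (t - s))
    (hmax : ∀ t x, 0 ≤ t → x₀ ≤ x → x < R → Γ t x ≤ Γmax)
    (hU : ∀ t x, 0 ≤ t → x₀ ≤ x → U t x ≤ α + β * (x - x₀))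
    (havg : ∀ t ∈ Icc 0 T, ∀ y, x₀ ≤ y → (c + δ) * (y - x₀) ≤ ∫ σ in x₀..y, Γ t σ)
    (hK : 2 / δ * (C + Γmax * β) + Γmax * (α + 1) ≤ K)
    (hR : x₀ + 2 / δ * Real.exp (K * T) < R) :
    ∀ t ∈ Icc 0 T, minUpper U Γ c x₀ t < R := by
  set L := minUpper U Γ c x₀ with hL
  -- Half the gap makes the energy coercive; the other half keeps the integrand nonpositive near
  -- contact.
  set k := c + δ / 2 with hk
  have hK0 : 0 ≤ K := le_trans (by positivity) hK
  have hlow : ∀ t ∈ Icc 0 T, L t - x₀ ≤ 2 / δ * energy U Γ c x₀ k t := by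
    intro t ht
    have h1 := havg t ht (L t) (h.le_minUpper' t)
    have h2 : energy U Γ c x₀ k t = (∫ σ in x₀..L t, Γ t σ) - (L t - x₀) * k := by
      rw [energy, intervalIntegral.integral_sub ((h.continuous_section t).intervalIntegrable _ _)
        (by simp), intervalIntegral.integral_const, smul_eq_mul]
    have h3 : δ / 2 * (L t - x₀) ≤ energy U Γ c x₀ k t := by
      rw [h2, hk]
      linarith
    calc L t - x₀ = 2 / δ * (δ / 2 * (L t - x₀)) := by field_simp
      _ ≤ _ := by gcongr
  have hbd : ∀ t ∈ Icc 0 T, energy U Γ c x₀ k t ≤ Real.exp (K * t) → L t < R := by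
    intro t ht he
    have h1 : Real.exp (K * t) ≤ Real.exp (K * T) :=
      Real.exp_le_exp.2 (mul_le_mul_of_nonneg_left ht.2 hK0)
    have h2 : 2 / δ * energy U Γ c x₀ k t ≤ 2 / δ * Real.exp (K * T) := by
      gcongr
      exact he.trans h1
    linarith [hlow t ht]
  suffices hE : ∀ t ∈ Icc 0 T, energy U Γ c x₀ k t ≤ Real.exp (K * t) from
    fun t ht => hbd t ht (hE t ht)
  refine le_of_left_continuous_of_right_step ?_ (h.tendsto_energy_left k)
    (ψ := fun t => Real.exp (K * t)) (by fun_prop) ?_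
  · simp [energy, h.minUpper_zero]
  intro t₀ ht₀ htT hle
  have htI : t₀ ∈ Icc 0 T := ⟨ht₀, htT.le⟩
  have hLR := hbd t₀ htI hle
  have hψ1 : 1 ≤ Real.exp (K * t₀) := Real.one_le_exp (by positivity)
  set ψ := Real.exp (K * t₀) with hψ
  have hℓ : L t₀ - x₀ ≤ 2 / δ * ψ := (hlow t₀ htI).trans (by gcongr)
  have hℓ0 : 0 ≤ L t₀ - x₀ := sub_nonneg.2 (h.le_minUpper' t₀)
  suffices hs : ∀ᶠ t in 𝓝[>] t₀, energy U Γ c x₀ k t ≤ energy U Γ c x₀ k t₀ +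
      (C * (L t₀ - x₀) + Γmax * (α + β * (L t₀ - x₀) + 1)) * (t - t₀) by
    filter_upwards [hs, self_mem_nhdsWithin] with t ht htt
    have htt' : 0 ≤ t - t₀ := sub_nonneg.2 (mem_Ioi.1 htt).le
    have h1 : C * (L t₀ - x₀) + Γmax * (α + β * (L t₀ - x₀) + 1) ≤ K * ψ := by
      calc C * (L t₀ - x₀) + Γmax * (α + β * (L t₀ - x₀) + 1)
          = (C + Γmax * β) * (L t₀ - x₀) + Γmax * (α + 1) * 1 := by ring
        _ ≤ (C + Γmax * β) * (2 / δ * ψ) + Γmax * (α + 1) * ψ := by gcongr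
        _ = (2 / δ * (C + Γmax * β) + Γmax * (α + 1)) * ψ := by ring
        _ ≤ K * ψ := by gcongr
    calc energy U Γ c x₀ k t ≤ ψ + K * ψ * (t - t₀) :=
          ht.trans (add_le_add hle (mul_le_mul_of_nonneg_right h1 htt'))
      _ = ψ * (K * (t - t₀) + 1) := by ring
      _ ≤ ψ * Real.exp (K * (t - t₀)) := by
          gcongr
          exact Real.add_one_le_exp _
      _ = Real.exp (K * t) := by
          rw [hψ, ← Real.exp_add]
          ring_nf
  rcases lt_or_ge c (Γ t₀ (L t₀)) with hcase | hcase
  -- Off contact `L` advances at speed at most `U + 1`, and each unit of length costs at most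
  -- `Γmax`.
  · have hev := h.eventually_le ht₀ le_rfl hcase (lt_add_one _)
    have hLev : ∀ᶠ t in 𝓝[>] t₀, L t < R :=
      ((h.continuousAt_of_lt ht₀ hcase).eventually_lt_const hLR).filter_mono nhdsWithin_le_nhds
    filter_upwards [hev, hLev, self_mem_nhdsWithin] with t h1 h2 htt
    have htt0 : t₀ < t := htt
    have h3 := h.energy_le_add (k := k) (B := Γmax) htt0.le
      (fun x hx => hlip t₀ t x ht₀ htt0.le hx) (fun x hx => by
        have := hmax t x (ht₀.trans htt0.le) ((h.le_minUpper' t₀).trans hx.1) (hx.2.trans_lt h2)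
        linarith)
    have h4 : L t - L t₀ ≤ (α + β * (L t₀ - x₀) + 1) * (t - t₀) := by
      have h5 := hU t₀ (L t₀) ht₀ (h.le_minUpper' t₀)
      have h6 : (U t₀ (L t₀) + 1) * (t - t₀) ≤ (α + β * (L t₀ - x₀) + 1) * (t - t₀) :=
        mul_le_mul_of_nonneg_right (by linarith) (by linarith)
      linarith
    have h7 := mul_le_mul_of_nonneg_left h4 hΓ0
    linarith
  -- At contact, the jump and a short stretch beyond it lie where `Γ t₀ ≤ c + δ/4`. Time drift adds
  -- less than `δ/4`, so the integrand stays at most `0` and the advance is free.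
  · set x₁ := Function.rightLim L t₀ with hx₁
    have hx₁c : Γ t₀ x₁ < c + δ / 4 :=
      (h.constraint_le_of_mem ht₀ hcase ⟨h.monotone_minUpper.le_rightLim le_rfl, le_rfl⟩).trans_lt
        (by linarith)
    obtain ⟨η, hη, hball⟩ := Metric.eventually_nhds_iff.1
      ((h.continuous_section t₀).continuousAt.eventually_lt_const hx₁c)
    have hLev : ∀ᶠ t in 𝓝[>] t₀, L t < x₁ + η :=
      (h.monotone_minUpper.tendsto_rightLim t₀).eventually_lt_const (by linarith)
    have hCev : ∀ᶠ t in 𝓝[>] t₀, C * (t - t₀) < δ / 4 := by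
      have : Continuous fun t => C * (t - t₀) := by fun_prop
      exact (this.continuousAt.eventually_lt_const (by simpa using hδ)).filter_mono
        nhdsWithin_le_nhds
    filter_upwards [hLev, hCev, self_mem_nhdsWithin] with t h1 h2 htt
    have htt0 : t₀ < t := htt
    have h3 := h.energy_le_add (k := k) (B := 0) htt0.le
      (fun x hx => hlip t₀ t x ht₀ htt0.le hx) (fun x hx => by
        have h4 := hlip t₀ t x ht₀ htt0.le ((h.le_minUpper' t₀).trans hx.1)
        have h5 : Γ t₀ x ≤ c + δ / 4 := by
          rcases le_or_gt x x₁ with hxx | hxx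
          · linarith [h.constraint_le_of_mem ht₀ hcase ⟨hx.1, hxx⟩]
          · refine (hball ?_).le
            rw [Real.dist_eq, abs_lt]
            constructor <;> linarith [hx.2]
        linarith)
    have h6 : 0 ≤ Γmax * (α + β * (L t₀ - x₀) + 1) * (t - t₀) := by
      have : 0 ≤ t - t₀ := by linarith
      positivity
    linarith

end Bound

/-! ### Uniformity in time of the averaged cohesion. -/

section Cohesion

open Filter Topology

variable {Γ : ℝ → ℝ → ℝ} {Γmax C c x₀ T : ℝ}

theorem abs_sub_le_of_abs_deriv_le
    (hΓ_cont : ContinuousOn (Function.uncurry Γ) (Ici 0 ×ˢ Ici 0))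
    (hΓ_deriv : ∀ t x, 0 < t → 0 ≤ x →
      DifferentiableAt ℝ (fun s => Γ s x) t ∧ |deriv (fun s => Γ s x) t| ≤ C)
    {s t x : ℝ} (hs : 0 ≤ s) (hst : s ≤ t) (hx : 0 ≤ x) : |Γ t x - Γ s x| ≤ C * (t - s) := by
  rcases hst.eq_or_lt with rfl | hlt
  · simp
  obtain ⟨r, hr, he⟩ := exists_deriv_eq_slope (fun s => Γ s x) hlt
    (hΓ_cont.comp (by fun_prop : Continuous fun r : ℝ => (r, x)).continuousOn
      fun r hr => ⟨hs.trans hr.1, hx⟩)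
    fun r hr => (hΓ_deriv r x (hs.trans_lt hr.1) hx).1.differentiableWithinAt
  have h1 := (hΓ_deriv r x (hs.trans_lt hr.1) hx).2
  rwa [he, abs_div, abs_of_pos (sub_pos.2 hlt), div_le_iff₀ (sub_pos.2 hlt)] at h1

theorem continuousOn_section (hΓ_cont : ContinuousOn (Function.uncurry Γ) (Ici 0 ×ˢ Ici 0))
    {t : ℝ} (ht : 0 ≤ t) : ContinuousOn (Γ t) (Ici 0) :=
  hΓ_cont.comp (Continuous.prodMk_right t).continuousOn fun _ hx => ⟨ht, hx⟩

theorem intervalIntegrable_section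
    (hΓ_cont : ContinuousOn (Function.uncurry Γ) (Ici 0 ×ˢ Ici 0)) {t a b : ℝ} (ht : 0 ≤ t)
    (ha : 0 ≤ a) (hab : a ≤ b) : IntervalIntegrable (Γ t) volume a b := by
  refine ((continuousOn_section hΓ_cont ht).mono ?_).intervalIntegrable
  rw [uIcc_of_le hab]
  exact fun x hx => ha.trans hx.1

theorem bddBelow_avg (hΓ_nonneg : ∀ t x, 0 ≤ t → 0 ≤ x → 0 ≤ Γ t x) (hx₀ : 0 ≤ x₀)
    {t : ℝ} (ht : 0 ≤ t) :
    BddBelow (range fun y : Ioi x₀ => (1 / ((y : ℝ) - x₀)) * ∫ σ in x₀..(y : ℝ), Γ t σ) := by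
  refine ⟨0, ?_⟩
  rintro _ ⟨⟨y, hy⟩, rfl⟩
  have hy' : 0 < y - x₀ := sub_pos.2 hy
  exact mul_nonneg (by positivity) (intervalIntegral.integral_nonneg (mem_Ioi.1 hy).le
    fun x hx => hΓ_nonneg t x ht (hx₀.trans hx.1))

theorem avgCohesion_mul_le (hΓ_nonneg : ∀ t x, 0 ≤ t → 0 ≤ x → 0 ≤ Γ t x) (hx₀ : 0 ≤ x₀)
    {t y : ℝ} (ht : 0 ≤ t) (hy : x₀ ≤ y) :
    avgCohesion Γ x₀ t * (y - x₀) ≤ ∫ σ in x₀..y, Γ t σ := by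
  rcases hy.eq_or_lt with rfl | hlt
  · simp
  have h1 : avgCohesion Γ x₀ t ≤ (1 / (y - x₀)) * ∫ σ in x₀..y, Γ t σ :=
    ciInf_le (bddBelow_avg hΓ_nonneg hx₀ ht) (⟨y, hlt⟩ : Ioi x₀)
  have hpos : 0 < y - x₀ := sub_pos.2 hlt
  calc avgCohesion Γ x₀ t * (y - x₀) ≤ (1 / (y - x₀)) * (∫ σ in x₀..y, Γ t σ) * (y - x₀) := by
        gcongr
    _ = _ := by field_simp

theorem avgCohesion_le_add
    (hΓ_cont : ContinuousOn (Function.uncurry Γ) (Ici 0 ×ˢ Ici 0))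
    (hΓ_nonneg : ∀ t x, 0 ≤ t → 0 ≤ x → 0 ≤ Γ t x) (hx₀ : 0 ≤ x₀) {s t d : ℝ}
    (hs : 0 ≤ s) (ht : 0 ≤ t) (hd : ∀ x, 0 ≤ x → Γ s x ≤ Γ t x + d) :
    avgCohesion Γ x₀ s ≤ avgCohesion Γ x₀ t + d := by
  have : Nonempty (Ioi x₀) := ⟨⟨x₀ + 1, by simp⟩⟩
  rw [← sub_le_iff_le_add]
  refine le_ciInf fun ⟨y, hy⟩ => ?_
  have hpos : 0 < y - x₀ := sub_pos.2 hy
  have h1 := avgCohesion_mul_le hΓ_nonneg hx₀ hs (mem_Ioi.1 hy).le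
  have h2 : ∫ σ in x₀..y, Γ s σ ≤ ∫ σ in x₀..y, (Γ t σ + d) :=
    intervalIntegral.integral_mono_on (mem_Ioi.1 hy).le
      (intervalIntegrable_section hΓ_cont hs hx₀ (mem_Ioi.1 hy).le)
      ((intervalIntegrable_section hΓ_cont ht hx₀ (mem_Ioi.1 hy).le).add (by simp))
      fun x hx => hd x (hx₀.trans hx.1)
  rw [intervalIntegral.integral_add (intervalIntegrable_section hΓ_cont ht hx₀ (mem_Ioi.1 hy).le)
    (by simp), intervalIntegral.integral_const, smul_eq_mul] at h2
  rw [one_div, inv_mul_eq_div, le_div_iff₀ hpos]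
  linarith

/-- The averaged cohesion inherits the Lipschitz bound of `Γ` in time, so it attains its minimum on
`[0, T]`. -/
theorem exists_uniform_gap
    (hΓ_cont : ContinuousOn (Function.uncurry Γ) (Ici 0 ×ˢ Ici 0))
    (hΓ_nonneg : ∀ t x, 0 ≤ t → 0 ≤ x → 0 ≤ Γ t x)
    (hΓ_deriv : ∀ t x, 0 < t → 0 ≤ x →
      DifferentiableAt ℝ (fun s => Γ s x) t ∧ |deriv (fun s => Γ s x) t| ≤ C)
    (hx₀ : 0 ≤ x₀) (hT : 0 ≤ T) (havg : ∀ t, 0 ≤ t → c < avgCohesion Γ x₀ t) :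
    ∃ δ > 0, ∀ t ∈ Icc 0 T, ∀ y, x₀ ≤ y → (c + δ) * (y - x₀) ≤ ∫ σ in x₀..y, Γ t σ := by
  have hC : 0 ≤ C := (abs_nonneg _).trans (hΓ_deriv 1 0 one_pos le_rfl).2
  have hlip : ∀ s t x, 0 ≤ s → 0 ≤ t → 0 ≤ x → Γ s x ≤ Γ t x + C * |s - t| := by
    intro s t x hs ht hx
    rcases le_total s t with h | h
    · have := (abs_le.1 (abs_sub_le_of_abs_deriv_le hΓ_cont hΓ_deriv hs h hx)).1
      rw [abs_sub_comm, abs_of_nonneg (sub_nonneg.2 h)]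
      linarith
    · have := (abs_le.1 (abs_sub_le_of_abs_deriv_le hΓ_cont hΓ_deriv ht h hx)).2
      rw [abs_of_nonneg (sub_nonneg.2 h)]
      linarith
  have hcont : ContinuousOn (avgCohesion Γ x₀) (Icc 0 T) := by
    refine (LipschitzOnWith.of_dist_le_mul (K := C.toNNReal) fun s hs t ht => ?_).continuousOn
    rw [Real.coe_toNNReal _ hC, Real.dist_eq, Real.dist_eq, abs_le]
    have h1 := avgCohesion_le_add hΓ_cont hΓ_nonneg hx₀ hs.1 ht.1 fun x hx =>
      hlip s t x hs.1 ht.1 hx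
    have h2 := avgCohesion_le_add hΓ_cont hΓ_nonneg hx₀ ht.1 hs.1 fun x hx =>
      hlip t s x ht.1 hs.1 hx
    rw [abs_sub_comm t s] at h2
    constructor <;> linarith
  obtain ⟨τ, hτ, hmin⟩ := isCompact_Icc.exists_isMinOn ⟨0, left_mem_Icc.2 hT⟩ hcont
  refine ⟨avgCohesion Γ x₀ τ - c, sub_pos.2 (havg τ hτ.1), fun t ht y hy => ?_⟩
  refine le_trans ?_ (avgCohesion_mul_le hΓ_nonneg hx₀ ht.1 hy)
  rw [add_sub_cancel]
  exact mul_le_mul_of_nonneg_right (isMinOn_iff.1 hmin t ht) (sub_nonneg.2 hy)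

/-- Otherwise `Γ t < c` on a short interval to the right of `x₀`, and the mean over it would be at
most `c`. -/
theorem le_start_of_lt_avgCohesion
    (hΓ_cont : ContinuousOn (Function.uncurry Γ) (Ici 0 ×ˢ Ici 0))
    (hΓ_nonneg : ∀ t x, 0 ≤ t → 0 ≤ x → 0 ≤ Γ t x) (hx₀ : 0 ≤ x₀) {t : ℝ} (ht : 0 ≤ t)
    (havg : c < avgCohesion Γ x₀ t) : c ≤ Γ t x₀ := by
  by_contra! hlt
  have hcw : ContinuousWithinAt (Γ t) (Ici x₀) x₀ :=
    (continuousOn_section hΓ_cont ht x₀ hx₀).mono (Ici_subset_Ici.2 hx₀)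
  obtain ⟨y, hy, hsub⟩ := mem_nhdsGE_iff_exists_Icc_subset.1 (hcw.eventually_lt_const hlt)
  have h1 := avgCohesion_mul_le hΓ_nonneg hx₀ ht (le_of_lt hy)
  have h2 : ∫ σ in x₀..y, Γ t σ ≤ ∫ _σ in x₀..y, c :=
    intervalIntegral.integral_mono_on (le_of_lt hy)
      (intervalIntegrable_section hΓ_cont ht hx₀ (le_of_lt hy)) (by simp)
      fun x hx => (hsub hx : Γ t x < c).le
  rw [intervalIntegral.integral_const, smul_eq_mul] at h2
  have hpos : 0 < y - x₀ := sub_pos.2 hy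
  nlinarith [mul_pos hpos (sub_pos.2 havg)]

end Cohesion

/-! ### Assembly of the generalized solution and truncation of the data. -/

section Existence

open Filter Topology

theorem Monotone.boundedVariationOn_Icc {f : ℝ → ℝ} (hf : Monotone f) (a b : ℝ) :
    BoundedVariationOn f (Icc a b) :=
  (hf.monotoneOn _).boundedVariationOn (C := max |f a| |f b|) fun _ hx =>
    abs_le_max_abs_abs (hf hx.1) (hf hx.2)

variable {U Γ : ℝ → ℝ → ℝ} {c x₀ T : ℝ}

/-- Only values along `L` matter; this passes from truncated to original data. -/
theorem IsGeneralizedSolution.congr {U' Γ' : ℝ → ℝ → ℝ} {L La Ls μa : ℝ → ℝ} {μ μs : LinfDual T}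
    (h : IsGeneralizedSolution U Γ c x₀ T L La Ls μ μa μs)
    (hU : ∀ t ∈ Icc 0 T, U t (L t) = U' t (L t)) (hΓ : ∀ t ∈ Icc 0 T, Γ t (L t) = Γ' t (L t)) :
    IsGeneralizedSolution U' Γ' c x₀ T L La Ls μ μa μs := by
  have hIoo : ∀ᵐ t ∂(vol T), t ∈ Icc 0 T := by
    filter_upwards [ae_restrict_mem measurableSet_Ioo] with t ht using ⟨ht.1.le, ht.2.le⟩
  have hae : (fun t => Γ t (L t)) =ᵐ[vol T] fun t => Γ' t (L t) := by
    filter_upwards [hIoo] with t ht using hΓ t ht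
  have hmem : MemLp (fun t => Γ' t (L t)) ∞ (vol T) := h.memLp_Γ.ae_eq hae
  exact {
    nonneg := h.nonneg
    init := h.init
    decomp_L := h.decomp_L
    decomp_μ := h.decomp_μ
    eq_ac := by
      filter_upwards [h.eq_ac, hIoo] with t ht htT
      rwa [← hU t htT]
    eq_singular := h.eq_singular
    normal_ac := by
      filter_upwards [h.normal_ac, hIoo] with t ht htT
      rwa [← hΓ t htT]
    memLp_Γ := hmem
    normal_singular := by
      rw [← MemLp.toLp_congr h.memLp_Γ hmem hae]
      exact h.normal_singular }

/-- The singular part of a monotone function that is constant to the left of `0`. -/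
theorem Monotone.singular_part {L : ℝ → ℝ} (hL : Monotone L) (hL0 : ∀ t ≤ 0, L t = L 0)
    (hT : 0 ≤ T) :
    Monotone (fun t => L t - (L 0 + ∫ s in (0 : ℝ)..t, deriv L s)) ∧
      (∀ t ≤ 0, L t - (L 0 + ∫ s in (0 : ℝ)..t, deriv L s) = 0) ∧
      (∀ᵐ t ∂(vol T), HasDerivAt (fun t => L 0 + ∫ s in (0 : ℝ)..t, deriv L s) (deriv L t) t) ∧
      ∀ᵐ t ∂(vol T), HasDerivAt (fun t => L t - (L 0 + ∫ s in (0 : ℝ)..t, deriv L s)) 0 t := by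
  have hint : ∀ a b, IntervalIntegrable (deriv L) volume a b := fun a b =>
    (hL.monotoneOn _).intervalIntegrable_deriv
  have hderiv : ∀ᵐ t ∂(vol T),
      HasDerivAt (fun t => L 0 + ∫ s in (0 : ℝ)..t, deriv L s) (deriv L t) t := by
    filter_upwards [ae_restrict_mem measurableSet_Ioo,
      ae_restrict_of_ae (hint 0 T).ae_hasDerivAt_integral] with t ht h
    refine (h ?_ 0 left_mem_uIcc).const_add _
    rw [uIcc_of_le hT]
    exact ⟨ht.1.le, ht.2.le⟩
  refine ⟨fun a b hab => ?_, fun t ht => ?_, hderiv, ?_⟩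
  -- The integral of the derivative of a monotone function does not exceed its increment.
  · have h1 := (hL.monotoneOn (uIcc a b)).intervalIntegral_deriv_mem_uIcc
    rw [uIcc_of_le (sub_nonneg.2 (hL hab))] at h1
    have h2 := intervalIntegral.integral_add_adjacent_intervals (hint 0 a) (hint a b)
    dsimp only
    linarith [h1.2]
  · have h1 := (hL.monotoneOn (uIcc 0 t)).intervalIntegral_deriv_mem_uIcc
    rw [hL0 t ht, sub_self, uIcc_self, mem_singleton_iff] at h1
    rw [hL0 t ht, h1]
    ring
  · filter_upwards [hderiv, ae_restrict_of_ae hL.ae_differentiableAt] with t h1 h2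
    exact (h2.hasDerivAt.fun_sub h1).congr_deriv (sub_self _)

/-- The minimal upper function is a generalized solution. -/
theorem IsRegular.exists_isGeneralizedSolution (h : IsRegular U Γ c x₀) (hx₀ : 0 ≤ x₀)
    (hT : 0 < T) :
    ∃ (La Ls : ℝ → ℝ) (μ : LinfDual T) (μa : ℝ → ℝ) (μs : LinfDual T),
      IsGeneralizedSolution U Γ c x₀ T (minUpper U Γ c x₀) La Ls μ μa μs := by
  have hmono := h.monotone_minUpper
  have hzero := h.minUpper_zero
  have hL0 : ∀ t ≤ 0, minUpper U Γ c x₀ t = minUpper U Γ c x₀ 0 := fun t ht => by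
    rw [hzero, h.minUpper_of_nonpos ht]
  obtain ⟨M, hM⟩ := h.bdd
  set L := minUpper U Γ c x₀ with hL
  obtain ⟨hs_mono, hs_zero, ha_deriv, hs_deriv⟩ := Monotone.singular_part hmono hL0 hT.le
  set La : ℝ → ℝ := fun t => L 0 + ∫ s in (0 : ℝ)..t, deriv L s with hLa
  have hint : IntervalIntegrable (deriv L) volume 0 T :=
    (hmono.monotoneOn _).intervalIntegrable_deriv
  obtain ⟨μs, hsing, hdistr, hneg, hvanish⟩ := exists_singular_functional hT.le hs_mono
    (fun t ht => by rw [hs_zero t ht, hs_zero 0 le_rfl]) hs_deriv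
  have hIoo : ∀ᵐ t ∂(vol T), t ∈ Ioo 0 T := ae_restrict_mem measurableSet_Ioo
  have hμa : Integrable (fun t => U t (L t) - deriv L t) (vol T) := by
    refine Integrable.sub ?_ ((intervalIntegrable_iff_integrableOn_Ioo_of_le hT.le).1 hint)
    refine Integrable.of_bound (C := M)
      (h.contU.measurable.comp (measurable_id.prodMk hmono.measurable)).aestronglyMeasurable
      (Eventually.of_forall fun t => ?_)
    rw [Real.norm_of_nonneg (h.nonneg _ _)]
    exact hM _ _
  have hcΓ : ContinuousOn (fun t => Γ t (L t)) (Icc 0 T) :=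
    h.continuousOn_constraint.mono Icc_subset_Ici_self
  have hmem : MemLp (fun t => Γ t (L t)) ∞ (vol T) := by
    obtain ⟨B, hB⟩ := isCompact_Icc.exists_bound_of_continuousOn hcΓ
    refine memLp_top_of_bound
      (h.contΓ.measurable.comp (measurable_id.prodMk hmono.measurable)).aestronglyMeasurable B ?_
    filter_upwards [hIoo] with t ht using hB t ⟨ht.1.le, ht.2.le⟩
  have hconstr : ∀ t, 0 ≤ t → c ≤ Γ t (L t) := h.isUpper_minUpper.constr
  refine ⟨La, fun t => L t - La t, integralDual _ hμa + μs, fun t => U t (L t) - deriv L t, μs, {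
    nonneg := fun t _ => hx₀.trans (h.le_minUpper' t)
    init := hzero
    decomp_L := {
      bv := Monotone.boundedVariationOn_Icc hmono 0 T
      ac := AbsolutelyContinuousOnInterval.add
        (LipschitzOnWith.absolutelyContinuousOnInterval (LipschitzWith.const (L 0)).lipschitzOnWith)
        (hint.absolutelyContinuousOnInterval_intervalIntegral left_mem_uIcc)
      bv_singular := Monotone.boundedVariationOn_Icc hs_mono 0 T
      deriv_singular := hs_deriv
      decomp := fun t _ => (add_sub_cancel (La t) (L t)).symm }
    decomp_μ := {
      integrable := hμa
      singular := hsing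
      decomp := fun φ => by rw [add_apply, integralDual_apply] }
    eq_ac := by
      filter_upwards [ha_deriv] with t ht
      exact ⟨ht.differentiableAt, by rw [ht.deriv]; ring⟩
    eq_singular := hdistr
    normal_ac := by
      filter_upwards [hIoo, ae_restrict_of_ae hmono.ae_differentiableAt] with t ht hd
      refine ⟨hconstr t ht.1.le, fun ζ hζ => ?_⟩
      rcases (hconstr t ht.1.le).eq_or_lt with he | hlt
      · rw [← he]
        exact mul_nonneg_of_nonpos_of_nonpos (sub_nonpos.2 (h.le_deriv ht.1.le hd))
          (sub_nonpos.2 hζ)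
      · rw [h.deriv_eq_of_lt ht.1.le hd hlt]
        rw [sub_self, zero_mul]
    memLp_Γ := hmem
    normal_singular := ?_ }⟩
  have hcmem : MemLp (fun _ : ℝ => c) ∞ (vol T) := memLp_top_const c
  refine ⟨?_, fun y hy => ?_⟩
  · filter_upwards [hmem.coeFn_toLp, hIoo] with t ht htT
    rw [ht]
    exact hconstr t htT.1.le
  -- The normal cone inequality splits at the constant `c`: `μs` vanishes on `Γ(·,L) - c` and is
  -- nonpositive on `y - c ≥ 0`.
  have h1 : μs (hmem.toLp - hcmem.toLp) = 0 := by
    refine hvanish (fun t => Γ t (L t) - c) (hcΓ.sub continuousOn_const)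
      (fun t ht => sub_nonneg.2 (hconstr t ht.1)) ?_ _ ?_
    · intro a b ha hab _ hpos
      have h2 := h.sub_eq_integral_deriv ha hab fun t ht => sub_pos.1 (hpos t ht)
      have h3 := intervalIntegral.integral_add_adjacent_intervals
        ((hmono.monotoneOn (uIcc 0 a)).intervalIntegrable_deriv)
        ((hmono.monotoneOn (uIcc a b)).intervalIntegrable_deriv)
      linarith
    · filter_upwards [Lp.coeFn_sub hmem.toLp hcmem.toLp, hmem.coeFn_toLp, hcmem.coeFn_toLp]
        with t e1 e2 e3
      rw [e1, Pi.sub_apply, e2, e3]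
  have h2 : μs (y - hcmem.toLp) ≤ 0 := by
    refine hneg _ ?_
    filter_upwards [Lp.coeFn_sub y hcmem.toLp, hcmem.coeFn_toLp, hy] with t e1 e2 e3
    rw [e1, Pi.sub_apply, e2]
    exact sub_nonneg.2 e3
  rw [map_sub] at h1 h2 ⊢
  linarith

/-- Extension of `U` from the quadrant to the plane, frozen for `x ≥ R`. -/
noncomputable def truncU (U : ℝ → ℝ → ℝ) (R t x : ℝ) : ℝ := U (max t 0) (min (max x 0) R)

/-- Extension of `Γ` from the quadrant to the plane, made large for `x > R`. -/
noncomputable def truncΓ (Γ : ℝ → ℝ → ℝ) (c R t x : ℝ) : ℝ :=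
  Γ (max t 0) (max x 0) + c * max 0 (x - R)

theorem le_linear_of_lipschitzOnWith {U0max : ℝ} {K : ℝ≥0}
    (hU_lip : ∀ t, 0 ≤ t → LipschitzOnWith K (U t) (Ici 0))
    (hU_zero : ∀ t, 0 ≤ t → U t 0 ≤ U0max) {t x : ℝ} (ht : 0 ≤ t) (hx : 0 ≤ x) :
    U t x ≤ U0max + K * x := by
  have h1 := (hU_lip t ht).dist_le_mul x hx 0 self_mem_Ici
  rw [Real.dist_eq, Real.dist_eq, sub_zero, abs_of_nonneg hx] at h1
  linarith [(abs_le.1 h1).2, hU_zero t ht]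

theorem isRegular_trunc {U0max R : ℝ} {K : ℝ≥0}
    (hU_cont : ContinuousOn (Function.uncurry U) (Ici 0 ×ˢ Ici 0))
    (hU_lip : ∀ t, 0 ≤ t → LipschitzOnWith K (U t) (Ici 0))
    (hU_nonneg : ∀ t x, 0 ≤ t → 0 ≤ x → 0 ≤ U t x)
    (hU_zero : ∀ t, 0 ≤ t → U t 0 ≤ U0max)
    (hΓ_cont : ContinuousOn (Function.uncurry Γ) (Ici 0 ×ˢ Ici 0))
    (hΓ_nonneg : ∀ t x, 0 ≤ t → 0 ≤ x → 0 ≤ Γ t x)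
    (hc : 0 ≤ c) (hx₀ : 0 ≤ x₀) (hR : 0 ≤ R) (hstart : c ≤ Γ 0 x₀) :
    IsRegular (truncU U R) (truncΓ Γ c R) c x₀ where
  contU := hU_cont.comp_continuous
    (f := fun p : ℝ × ℝ => (max p.1 0, min (max p.2 0) R)) (by fun_prop)
    fun p => ⟨le_max_right p.1 0, le_min (le_max_right p.2 0) hR⟩
  contΓ := (hΓ_cont.comp_continuous (f := fun p : ℝ × ℝ => (max p.1 0, max p.2 0)) (by fun_prop)
    fun p => ⟨le_max_right p.1 0, le_max_right p.2 0⟩).add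
      (g := fun p : ℝ × ℝ => c * max 0 (p.2 - R)) (by fun_prop)
  nonneg t x := hU_nonneg _ _ (le_max_right _ _) (le_min (le_max_right _ _) hR)
  bdd := by
    refine ⟨U0max + K * R, fun t x => ?_⟩
    refine (le_linear_of_lipschitzOnWith hU_lip hU_zero (le_max_right _ _)
      (le_min (le_max_right _ _) hR)).trans ?_
    gcongr
    exact min_le_right _ _
  far := by
    refine ⟨R + 1, fun t x hx => ?_⟩
    have h1 := hΓ_nonneg (max t 0) (max x 0) (le_max_right _ _) (le_max_right _ _)
    have h2 : c * 1 ≤ c * max 0 (x - R) :=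
      mul_le_mul_of_nonneg_left (le_max_of_le_right (by linarith)) hc
    simp only [truncΓ]
    linarith
  start := by
    have : 0 ≤ c * max 0 (x₀ - R) := mul_nonneg hc (le_max_left _ _)
    simp only [truncΓ, max_self, max_eq_left hx₀]
    linarith

end Existence

end Disturbance

theorem theorem2p2
    (U Γ : ℝ → ℝ → ℝ) (ULip : ℝ≥0) (U0max Γmax CΓ Γstar L₀ T : ℝ)
    (hT : 0 < T) (hL₀ : 0 ≤ L₀) (hΓstar : 0 < Γstar)
    -- assumptions on the velocity
    (hU_cont : ContinuousOn (Function.uncurry U) (Ici 0 ×ˢ Ici 0))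
    (hU_lip : ∀ t, 0 ≤ t → LipschitzOnWith ULip (U t) (Ici 0))
    (hU_nonneg : ∀ t x, 0 ≤ t → 0 ≤ x → 0 ≤ U t x)
    (hU_zero : ∀ t, 0 ≤ t → U t 0 ≤ U0max)
    -- assumptions on the cohesion
    (hΓ_cont : ContinuousOn (Function.uncurry Γ) (Ici 0 ×ˢ Ici 0))
    (hΓ_bdd : ∀ t x, 0 ≤ t → 0 ≤ x → 0 ≤ Γ t x ∧ Γ t x ≤ Γmax)
    (hΓ_deriv : ∀ t x, 0 < t → 0 ≤ x →
      DifferentiableAt ℝ (fun s => Γ s x) t ∧ |deriv (fun s => Γ s x) t| ≤ CΓ)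
    (hΓ_avg : ∀ t, 0 ≤ t → Γstar < Disturbance.avgCohesion Γ L₀ t) :
    ∃ (L La Ls : ℝ → ℝ) (μ : Disturbance.LinfDual T) (μa : ℝ → ℝ)
      (μs : Disturbance.LinfDual T),
      Disturbance.IsGeneralizedSolution U Γ Γstar L₀ T L La Ls μ μa μs := by
  open Disturbance in
  have hΓ_nonneg : ∀ t x, 0 ≤ t → 0 ≤ x → 0 ≤ Γ t x := fun t x ht hx => (hΓ_bdd t x ht hx).1
  have hCΓ : 0 ≤ CΓ := (abs_nonneg _).trans (hΓ_deriv 1 0 one_pos le_rfl).2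
  have hΓmax : 0 ≤ Γmax := (hΓ_nonneg 0 0 le_rfl le_rfl).trans (hΓ_bdd 0 0 le_rfl le_rfl).2
  have hU0max : 0 ≤ U0max := (hU_nonneg 0 0 le_rfl le_rfl).trans (hU_zero 0 le_rfl)
  obtain ⟨δ, hδ, hgap⟩ := exists_uniform_gap hΓ_cont hΓ_nonneg hΓ_deriv hL₀ hT.le hΓ_avg
  set α := U0max + ULip * L₀ with hα
  have hα0 : 0 ≤ α := by positivity
  set K := 2 / δ * (CΓ + Γmax * ULip) + Γmax * (α + 1) with hK
  -- `K` and `R` depend on the original data only, so the bound for the truncated problem can be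
  -- compared with its own truncation level.
  set R := L₀ + 2 / δ * Real.exp (K * T) + 1 with hR
  have hR0 : 0 ≤ R := by positivity
  have hreg : IsRegular (truncU U R) (truncΓ Γ Γstar R) Γstar L₀ :=
    isRegular_trunc hU_cont hU_lip hU_nonneg hU_zero hΓ_cont hΓ_nonneg hΓstar.le hL₀ hR0
      (le_start_of_lt_avgCohesion hΓ_cont hΓ_nonneg hL₀ le_rfl (hΓ_avg 0 le_rfl))
  have hlt : ∀ t ∈ Icc 0 T, minUpper (truncU U R) (truncΓ Γ Γstar R) Γstar L₀ t < R := by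
    refine hreg.minUpper_lt hΓstar.le hδ hCΓ hΓmax hα0 ULip.coe_nonneg ?_ ?_ ?_ ?_ hK.ge
      (lt_add_one _)
    · intro s t x hs hst hx
      simp only [truncΓ, max_eq_left hs, max_eq_left (hs.trans hst), max_eq_left (hL₀.trans hx)]
      linarith [(abs_le.1 (abs_sub_le_of_abs_deriv_le hΓ_cont hΓ_deriv hs hst (hL₀.trans hx))).2]
    · intro t x ht hx hxR
      simp only [truncΓ, max_eq_left ht, max_eq_left (hL₀.trans hx),
        max_eq_left (sub_nonpos.2 hxR.le), mul_zero, add_zero]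
      exact (hΓ_bdd t x ht (hL₀.trans hx)).2
    · intro t x ht hx
      simp only [truncU, max_eq_left ht, max_eq_left (hL₀.trans hx)]
      refine (le_linear_of_lipschitzOnWith hU_lip hU_zero ht (le_min (hL₀.trans hx) hR0)).trans ?_
      calc U0max + ULip * min x R ≤ U0max + ULip * x := by
            gcongr
            exact min_le_left _ _
        _ = α + ULip * (x - L₀) := by ring
    -- Truncation only increases `Γ`, so the gap inequality persists.
    · intro t ht y hy
      refine (hgap t ht y hy).trans (intervalIntegral.integral_mono_on hy
        (intervalIntegrable_section hΓ_cont ht.1 hL₀ hy)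
        ((hreg.continuous_section t).intervalIntegrable _ _) fun x hx => ?_)
      have := mul_nonneg hΓstar.le (le_max_left 0 (x - R))
      simp only [truncΓ, max_eq_left ht.1, max_eq_left (hL₀.trans hx.1)]
      linarith
  obtain ⟨La, Ls, μ, μa, μs, hsol⟩ := hreg.exists_isGeneralizedSolution hL₀ hT
  refine ⟨_, La, Ls, μ, μa, μs, hsol.congr (fun t ht => ?_) fun t ht => ?_⟩
  · simp only [truncU, max_eq_left ht.1, max_eq_left (hsol.nonneg t ht),
      min_eq_left (hlt t ht).le]
  · simp only [truncΓ, max_eq_left ht.1, max_eq_left (hsol.nonneg t ht),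
      max_eq_left (sub_nonpos.2 (hlt t ht).le), mul_zero, add_zero]
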